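/- **Notation.** Let $p\ge 0$, $m\ge 1$ and let $q=2m+1\ge 3$ be odd. Let $\mathbb{R}_{p+q}$ be the real Clifford algebra generated by $e_1,\dots,e_{p+q}$ with $e_ie_j+e_je_i=-2\delta_{ij}$, let $e_0=1$, and let $a\mapsto\overline{a}$ be the Clifford conjugation. A point of $\mathbb{R}^{p+q+1}$ is identified with the paravector $\boldsymbol{x}=\boldsymbol{x}_p+\underline{\boldsymbol{x}}_q$, where $\boldsymbol{x}_p=\sum_{i=0}^{p}x_ie_i\in\mathbb{R}^{p+1}$ and $\underline{\boldsymbol{x}}_q=\sum_{i=p+1}^{p+q}x_ie_i\in\mathbb{R}^{q}$; put $\boldsymbol{x}_\diamond=\boldsymbol{x}_p-\underline{\boldsymbol{x}}_q$, and let $\mathbb{S}$ be the unit sphere of $\mathbb{R}^q$. Let $D\subseteq\mathbb{R}^{p+2}$ be open and invariant under $\boldsymbol{x}'=(\boldsymbol{x}_p,r)\mapsto \boldsymbol{x}'_\diamond=(\boldsymbol{x}_p,-r)$ (for instance a domain with this property), and let $\Omega_D=\{\boldsymbol{x}_p+r\underline{\omega}:\ \underline{\omega}\in\mathbb{S},\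 r\ge 0,\ (\boldsymbol{x}_p,r)\in D\}\subseteq\mathbb{R}^{p+q+1}$. Write $D_{\boldsymbol{x}_p}=\sum_{i=0}^{p}e_i\partial_{x_i}$, $\overline{D}_{\boldsymbol{x}_p}=\sum_{i=0}^{p}\overline{e_i}\,\partial_{x_i}$, and let $\Delta$ be the Laplacian of $\mathbb{R}^{p+q+1}$. A function $f:\Omega_D\to\mathbb{R}_{p+q}$ is a *generalized partial-slice function* if there are $F_1,F_2:D\to\mathbb{R}_{p+q}$ with $F_1(\boldsymbol{x}'_\diamond)=F_1(\boldsymbol{x}')$, $F_2(\boldsymbol{x}'_\diamond)=-F_2(\boldsymbol{x}')$ and $f(\boldsymbol{x}_p+r\underline{\omega})=F_1(\boldsymbol{x}_p,r)+\underline{\omega}F_2(\boldsymbol{x}_p,r)$ for all $(\boldsymbol{x}_p,r)\in D$ and $\underline{\omega}\in\mathbb{S}$. It is *generalized partial-slice regular* if moreover $F_1,F_2\in C^1(D)$ and $D_{\boldsymbol{x}_p}F_1-\partial_rF_2=0$, $\overline{D}_{\boldsymbol{x}_p}F_2+\partial_rF_1=0$ on $D$. Its spherical value is $f_s^\circ(\boldsymbol{x})=\frac12(f(\boldsymbol{x})+f(\boldsymbol{x}_\diamond))$,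 and its spherical derivative is $f_s'(\boldsymbol{x})=\frac12\,\underline{\boldsymbol{x}}_q^{-1}(f(\boldsymbol{x})-f(\boldsymbol{x}_\diamond))$ for $\underline{\boldsymbol{x}}_q\ne0$. A function $h:\Omega_D\to\mathbb{R}_{p+q}$ is *symmetric with respect to $\mathbb{R}^{p+1}$* if $h(\boldsymbol{x}_p+|\underline{\boldsymbol{x}}_q|I)=h(\boldsymbol{x}_p+|\underline{\boldsymbol{x}}_q|J)$ for all $\boldsymbol{x}\in\Omega_D$ and $I,J\in\mathbb{S}$; it is *polyharmonic of degree $m$* if $h\in C^{2m}(\Omega_D)$ and $\Delta^mh=0$ on $\Omega_D$. **Theorem.** (i) If $f$ is generalized partial-slice regular on $\Omega_D$, then there is exactly one pair of functions $A,B:\Omega_D\to\mathbb{R}_{p+q}$, both polyharmonic of degree $m$ and symmetric with respect to $\mathbb{R}^{p+1}$, such that $$f(\boldsymbol{x})=A(\boldsymbol{x})-\overline{\boldsymbol{x}}\,B(\boldsymbol{x}),\qquad \boldsymbol{x}\in\Omega_D.$$ Explicitly, $B(\boldsymbol{x})=f_s'(\boldsymbol{x})$ for $\boldsymbol{x}\in\Omega_D\setminus\mathbb{R}^{p+1}$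 (so that $B$ is the continuous extension of $f_s'$ to $\Omega_D$), and $A(\boldsymbol{x})=f_s^\circ(\boldsymbol{x})+\overline{\boldsymbol{x}}_p\,B(\boldsymbol{x})$ for $\boldsymbol{x}\in\Omega_D$. (ii) Conversely, let $A,B:\Omega_D\to\mathbb{R}_{p+q}$ be of class $C^1$ and symmetric with respect to $\mathbb{R}^{p+1}$. Then $g(\boldsymbol{x})=A(\boldsymbol{x})-\overline{\boldsymbol{x}}\,B(\boldsymbol{x})$ is a generalized partial-slice function on $\Omega_D$. Moreover $g$ is generalized partial-slice regular if and only if, with $A(\boldsymbol{x}')=A(\boldsymbol{x}_p+r\underline{\omega})$ and $B(\boldsymbol{x}')=B(\boldsymbol{x}_p+r\underline{\omega})$ (which do not depend on $\underline{\omega}\in\mathbb{S}$), for all $\boldsymbol{x}'=(\boldsymbol{x}_p,r)\in D$, $$\begin{cases} D_{\boldsymbol{x}_p}A(\boldsymbol{x}')-\sum_{i=0}^{p}e_i\,\overline{\boldsymbol{x}}_p\,\partial_{x_i}B(\boldsymbol{x}')-r\,\partial_rB(\boldsymbol{x}')=(p+2)\,B(\boldsymbol{x}'),\\[2pt] \partial_rA(\boldsymbol{x}')-\overline{\boldsymbol{x}}_p\,\partial_rB(\boldsymbol{x}')+r\,\overline{D}_{\boldsymbol{x}_p}B(\boldsymbol{x}')=0.\end{cases}$$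 -/

import Mathlib

noncomputable section

namespace PartialSlice

/-! ### The real Clifford algebra -/

/-- The negative definite quadratic form `v ↦ -(v₁² + ⋯ + vₙ²)` on `ℝⁿ`. -/
def negForm (n : ℕ) : QuadraticForm ℝ (Fin n → ℝ) :=
  QuadraticMap.weightedSumSquares ℝ (fun _ : Fin n => (-1 : ℝ))

/-- The real Clifford algebra `ℝₙ`: generators `e₁, …, eₙ` with `eᵢ eⱼ + eⱼ eᵢ = -2 δᵢⱼ`.
The Clifford conjugation is `star`. -/
abbrev Cl (n : ℕ) : Type := CliffordAlgebra (negForm n)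

/-- The generators of `ℝₙ` (the index is shifted by one). -/
def gen (n : ℕ) (i : Fin n) : Cl n :=
  CliffordAlgebra.ι (negForm n) (Pi.single i 1)

/-- A basis of `ℝₙ` indexed by the subsets of `{1, …, n}`: it corresponds to the exterior
products `e_{j₁} ∧ ⋯ ∧ e_{jᵣ}` under the linear isomorphism with the exterior algebra. -/
def clBasis (n : ℕ) : Module.Basis (Finset (Fin n)) ℝ (Cl n) :=
  ((Pi.basisFun ℝ (Fin n)).ExteriorAlgebra).map
    (CliffordAlgebra.equivExterior (negForm n)).symm

/-- The coordinates of an element of `ℝₙ`, as a Euclidean vector. -/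
def clCoord (n : ℕ) : Cl n →ₗ[ℝ] EuclideanSpace ℝ (Finset (Fin n)) :=
  (WithLp.linearEquiv 2 ℝ (Finset (Fin n) → ℝ)).symm.toLinearMap ∘ₗ
    (clBasis n).equivFun.toLinearMap

theorem clCoord_injective (n : ℕ) : Function.Injective (clCoord n) :=
  (WithLp.linearEquiv 2 ℝ (Finset (Fin n) → ℝ)).symm.injective.comp
    (clBasis n).equivFun.injective

/-- The Euclidean norm of the coordinates. It only serves to express continuity and
differentiability of `ℝₙ`-valued functions, for which all norms on the finite dimensional
space `ℝₙ` are interchangeable. -/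
instance instNormedAddCommGroupCl (n : ℕ) : NormedAddCommGroup (Cl n) :=
  NormedAddCommGroup.induced (Cl n) (EuclideanSpace ℝ (Finset (Fin n))) (clCoord n)
    (clCoord_injective n)

instance instNormedSpaceCl (n : ℕ) : NormedSpace ℝ (Cl n) :=
  NormedSpace.induced ℝ (Cl n) (EuclideanSpace ℝ (Finset (Fin n))) (clCoord n)

/-! ### The spaces -/

/-- `ℝ^{p+1}`, with coordinates `x₀, …, x_p`. -/
abbrev RP (p : ℕ) : Type := EuclideanSpace ℝ (Fin (p + 1))

/-- `ℝ^q`, with coordinates `x_{p+1}, …, x_{p+q}`. -/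
abbrev RQ (q : ℕ) : Type := EuclideanSpace ℝ (Fin q)

/-- `ℝ^{p+q+1} = ℝ^{p+1} ⊕ ℝ^q` with its Euclidean structure; `x.fst` is `x_p` and `x.snd` is
the `q`-part of `x`. -/
abbrev RPQ (p q : ℕ) : Type := WithLp 2 (RP p × RQ q)

/-- The point `a + b` of `ℝ^{p+q+1}`, for `a ∈ ℝ^{p+1}` and `b ∈ ℝ^q`. -/
def pt {p q : ℕ} (a : RP p) (b : RQ q) : RPQ p q := WithLp.toLp 2 (a, b)

/-- The units `e₀ = 1, e₁, …, e_p` of `ℝ_{p+q}`. -/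
def unitP (p q : ℕ) (i : Fin (p + 1)) : Cl (p + q) :=
  Fin.cases 1 (fun j : Fin p => gen (p + q) (Fin.castAdd q j)) i

/-- The units `e_{p+1}, …, e_{p+q}` of `ℝ_{p+q}`. -/
def unitQ (p q : ℕ) (j : Fin q) : Cl (p + q) := gen (p + q) (Fin.natAdd p j)

/-- `ℝ^{p+1}` inside `ℝ_{p+q}`: `a ↦ ∑_{i=0}^{p} aᵢ eᵢ`. -/
def embP {p : ℕ} (q : ℕ) (a : RP p) : Cl (p + q) := ∑ i, a i • unitP p q i

/-- `ℝ^q` inside `ℝ_{p+q}`: `b ↦ ∑_{i=p+1}^{p+q} bᵢ eᵢ`. -/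
def embQ (p : ℕ) {q : ℕ} (b : RQ q) : Cl (p + q) := ∑ j, b j • unitQ p q j

/-- `ℝ^{p+q+1}` inside `ℝ_{p+q}` as the space of paravectors. -/
def emb {p q : ℕ} (x : RPQ p q) : Cl (p + q) := embP q x.fst + embQ p x.snd

/-- The unit sphere `𝕊` of `ℝ^q`. -/
def sph (q : ℕ) : Set (RQ q) := Metric.sphere 0 1

/-- `D ⊆ ℝ^{p+2} = ℝ^{p+1} × ℝ` is invariant under the reflection `(x_p, r) ↦ (x_p, -r)`. -/
def ReflInvariant {p : ℕ} (D : Set (RP p × ℝ)) : Prop :=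
  ∀ a r, (a, r) ∈ D → (a, -r) ∈ D

/-- The partially symmetric completion `Ω_D` of `D`. -/
def completion {p : ℕ} (q : ℕ) (D : Set (RP p × ℝ)) : Set (RPQ p q) :=
  {x | ∃ ω ∈ sph q, ∃ (a : RP p) (r : ℝ), 0 ≤ r ∧ (a, r) ∈ D ∧ x = pt a (r • ω)}

/-! ### Differential operators on `ℝ^{p+2}` -/

/-- `∂_{xᵢ}`, `0 ≤ i ≤ p`, in the variables `(x_p, r) ∈ ℝ^{p+2}`. -/
def dX {p n : ℕ} (i : Fin (p + 1)) (F : RP p × ℝ → Cl n) (y : RP p × ℝ) : Cl n :=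
  fderiv ℝ F y (EuclideanSpace.single i 1, 0)

/-- `∂_r` in the variables `(x_p, r) ∈ ℝ^{p+2}`. -/
def dR {p n : ℕ} (F : RP p × ℝ → Cl n) (y : RP p × ℝ) : Cl n :=
  fderiv ℝ F y (0, 1)

/-- `D_{x_p} = ∑_{i=0}^{p} eᵢ ∂_{xᵢ}`. -/
def dirac {p q : ℕ} (F : RP p × ℝ → Cl (p + q)) (y : RP p × ℝ) : Cl (p + q) :=
  ∑ i, unitP p q i * dX i F y

/-- The conjugate operator `∑_{i=0}^{p} ēᵢ ∂_{xᵢ}`. -/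
def diracBar {p q : ℕ} (F : RP p × ℝ → Cl (p + q)) (y : RP p × ℝ) : Cl (p + q) :=
  ∑ i, star (unitP p q i) * dX i F y

/-! ### Generalized partial-slice functions -/

/-- `f` is induced on `Ω_D` by the pair `(F₁, F₂)`, where `F₁` is even and `F₂` is odd in the
last variable. -/
structure IsInducedBy {p q : ℕ} (D : Set (RP p × ℝ)) (F₁ F₂ : RP p × ℝ → Cl (p + q))
    (f : RPQ p q → Cl (p + q)) : Prop where
  even : ∀ a r, (a, r) ∈ D → F₁ (a, -r) = F₁ (a, r)
  odd : ∀ a r, (a, r) ∈ D → F₂ (a, -r) = -F₂ (a, r)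
  eq : ∀ a r, (a, r) ∈ D → ∀ ω ∈ sph q,
    f (pt a (r • ω)) = F₁ (a, r) + embQ p ω * F₂ (a, r)

/-- `f` is a generalized partial-slice function on `Ω_D`. -/
def IsGS {p q : ℕ} (D : Set (RP p × ℝ)) (f : RPQ p q → Cl (p + q)) : Prop :=
  ∃ F₁ F₂ : RP p × ℝ → Cl (p + q), IsInducedBy D F₁ F₂ f

/-- `f` is generalized partial-slice regular on `Ω_D`: it is induced by a pair of `C¹` functions
that satisfies the generalized Cauchy-Riemann equations on `D`. -/
def IsGSR {p q : ℕ} (D : Set (RP p × ℝ)) (f : RPQ p q → Cl (p + q)) : Prop :=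
  ∃ F₁ F₂ : RP p × ℝ → Cl (p + q), IsInducedBy D F₁ F₂ f ∧
    ContDiffOn ℝ 1 F₁ D ∧ ContDiffOn ℝ 1 F₂ D ∧
    ∀ y ∈ D, dirac F₁ y - dR F₂ y = 0 ∧ diracBar F₂ y + dR F₁ y = 0

/-- The reflected point `x_⋄ = x_p - x_q` of `x = x_p + x_q`. -/
def refl {p q : ℕ} (x : RPQ p q) : RPQ p q := pt x.fst (-x.snd)

/-- The spherical value of `f`. -/
def sphVal {p q : ℕ} (f : RPQ p q → Cl (p + q)) (x : RPQ p q) : Cl (p + q) :=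
  (1 / 2 : ℝ) • (f x + f (refl x))

/-- The spherical derivative of `f`, at points outside `ℝ^{p+1}`. There the vector `x.snd` is
nonzero, hence invertible in `ℝ_{p+q}`. -/
def sphDeriv {p q : ℕ} (f : RPQ p q → Cl (p + q)) (x : RPQ p q) : Cl (p + q) :=
  (1 / 2 : ℝ) • (Ring.inverse (embQ p x.snd) * (f x - f (refl x)))

/-! ### Symmetric and polyharmonic functions -/

/-- `h` is symmetric on `Ω` with respect to `ℝ^{p+1}`. -/
def IsSymm {p q : ℕ} (Ω : Set (RPQ p q)) (h : RPQ p q → Cl (p + q)) : Prop :=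
  ∀ x ∈ Ω, ∀ I ∈ sph q, ∀ J ∈ sph q,
    h (pt x.fst (‖x.snd‖ • I)) = h (pt x.fst (‖x.snd‖ • J))

/-- `h` is polyharmonic of degree `m` on the open set `Ω`: it is of class `C^{2m}` and
`Δ^m h = 0` there. -/
def IsPolyharmonic {p q : ℕ} (m : ℕ) (Ω : Set (RPQ p q)) (h : RPQ p q → Cl (p + q)) : Prop :=
  ContDiffOn ℝ ((2 * m : ℕ) : ℕ∞) h Ω ∧
    ∀ x ∈ Ω, ((Laplacian.laplacian : (RPQ p q → Cl (p + q)) → RPQ p q → Cl (p + q))^[m] h) x = 0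

/-- A function on `Ω_D` in the variables `(x_p, r)`, on the slice in direction `ω ∈ 𝕊`. For a
function that is symmetric with respect to `ℝ^{p+1}` the choice of `ω` does not matter. -/
def slice {p q : ℕ} (ω : RQ q) (h : RPQ p q → Cl (p + q)) (y : RP p × ℝ) : Cl (p + q) :=
  h (pt y.1 (y.2 • ω))

/-- The first order system for a pair of functions `A`, `B` of the variables `(x_p, r) ∈ D`. -/
def FirstOrderSystem {p q : ℕ} (D : Set (RP p × ℝ)) (A B : RP p × ℝ → Cl (p + q)) : Prop :=
  ∀ y ∈ D,
    dirac A y - ∑ i, unitP p q i * (star (embP q y.1) * dX i B y) - y.2 • dR B y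
        = ((p : ℝ) + 2) • B y ∧
    dR A y - star (embP q y.1) * dR B y + y.2 • diracBar B y = 0

end PartialSlice

end

noncomputable section

namespace PartialSlice

/-! ### Algebra of the units -/

/-! The odd component is divisible by `r`: write `F₂ = r w` with `w` even. Since `x̄ = x̄_p - x_q`,
the pair `A = F₁ + x̄_p w`, `B = w`, read as functions of `(x_p, |x_q|)`, satisfies `f = A - x̄ B`.
All the work lies in the regularity and polyharmonicity of `A` and `B`.

Regularity. The Cauchy-Riemann system factorizes the Laplacian of `ℝ^{p+2}`, so `F₁` and `F₂` are
weakly harmonic, although only `C¹` a priori. A mean value identity against a smooth radial kernel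
makes them smooth (`contDiffOn_of_cauchyRiemann`). Hadamard's lemma then makes `w` smooth
(`contDiffOn_divR`), and an even smooth function of `(x_p, r)` gives a smooth function of `(x_p,
|x_q|)` (`contDiffOn_radial`).

Polyharmonicity. Put `T = r⁻¹ ∂_r` and `L_k = Δ_{x_p} + k T + r² T²`. On functions of `(x_p, |x_q|)`
the Laplacian of `ℝ^{p+q+1}` is `L_q` (`laplacian_radial`). The Cauchy-Riemann equations give `L_3 A
= L_3 B = 0` (`axialLap_of_cauchyRiemann`), and `T L_k = L_{k+2} T` (`radD_axialLap`). Hence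
`L_{3+2j} T^j u = 0` for `u = A, B`, so `Δ T^j u = (q - 3 - 2j) T^{j+1} u`. Iterating, `Δ^m u` is a
multiple of `T^m u` by a product whose last factor is `q - 3 - 2(m - 1) = 0`.

Uniqueness. Symmetry forces `B` to be the spherical derivative of `f` off `ℝ^{p+1}`, continuity
extends this, and then `A` is determined.

Converse. The function `A - x̄ B` is induced by `A - x̄_p B` and `r B`. Inducing pairs are unique,
so regularity amounts to the Cauchy-Riemann equations for this pair, which expand to the first order
system. -/

instance instFiniteDimensionalCl (n : ℕ) : FiniteDimensional ℝ (Cl n) :=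
  (clBasis n).finiteDimensional_of_finite

instance instCompleteSpaceCl (n : ℕ) : CompleteSpace (Cl n) := FiniteDimensional.complete ℝ (Cl n)

/-- Left multiplication as a continuous linear map. -/
def mulL {n : ℕ} (c : Cl n) : Cl n →L[ℝ] Cl n :=
  LinearMap.toContinuousLinearMap (LinearMap.mulLeft ℝ c)

@[simp]
theorem mulL_apply {n : ℕ} (c x : Cl n) : mulL c x = c * x := rfl

theorem negForm_apply {n : ℕ} (v : Fin n → ℝ) : negForm n v = -∑ i, v i ^ 2 := by
  simp [negForm, QuadraticMap.weightedSumSquares_apply, pow_two, Finset.sum_neg_distrib]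

theorem gen_mul_self {n : ℕ} (i : Fin n) : gen n i * gen n i = -1 := by
  rw [gen, CliffordAlgebra.ι_sq_scalar, negForm_apply]
  simp [Pi.single_apply, Finset.sum_ite_eq']

theorem gen_mul_gen_of_ne {n : ℕ} {i j : Fin n} (h : i ≠ j) :
    gen n i * gen n j + gen n j * gen n i = 0 := by
  rw [gen, gen, CliffordAlgebra.ι_mul_ι_add_swap, QuadraticMap.polar]
  have e : ∀ k, ((Pi.single i 1 + Pi.single j 1 : Fin n → ℝ) k) ^ 2
      = (Pi.single i 1 : Fin n → ℝ) k ^ 2 + (Pi.single j 1 : Fin n → ℝ) k ^ 2 := by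
    intro k
    by_cases h1 : k = i
    · subst h1; simp [h]
    · simp [h1]
  simp only [negForm_apply, e, Finset.sum_add_distrib]
  simp

@[simp]
theorem star_gen {n : ℕ} (i : Fin n) : star (gen n i) = -gen n i := by
  rw [gen, CliffordAlgebra.star_ι]

theorem unitP_zero (p q : ℕ) : unitP p q 0 = 1 := rfl

theorem unitP_succ (p q : ℕ) (j : Fin p) :
    unitP p q j.succ = gen (p + q) (Fin.castAdd q j) := rfl

theorem star_unitP_mul_self (p q : ℕ) (i : Fin (p + 1)) :
    star (unitP p q i) * unitP p q i = 1 := by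
  refine Fin.cases ?_ (fun j => ?_) i
  · simp [unitP_zero]
  · simp [unitP_succ, gen_mul_self]

theorem unitP_mul_star_self (p q : ℕ) (i : Fin (p + 1)) :
    unitP p q i * star (unitP p q i) = 1 := by
  refine Fin.cases ?_ (fun j => ?_) i
  · simp [unitP_zero]
  · simp [unitP_succ, gen_mul_self]

theorem star_unitP_mul_of_ne (p q : ℕ) {i j : Fin (p + 1)} (h : i ≠ j) :
    star (unitP p q i) * unitP p q j + star (unitP p q j) * unitP p q i = 0 := by
  induction i using Fin.cases with
  | zero =>
    induction j using Fin.cases with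
    | zero => exact absurd rfl h
    | succ j => simp [unitP_zero, unitP_succ]
  | succ i =>
    induction j using Fin.cases with
    | zero => simp [unitP_zero, unitP_succ]
    | succ j =>
      have hij : Fin.castAdd q i ≠ Fin.castAdd q j := fun e => h (by simpa using e)
      have := gen_mul_gen_of_ne hij
      simp only [unitP_succ, star_gen, neg_mul]
      rw [← neg_add, this, neg_zero]

theorem unitP_mul_star_of_ne (p q : ℕ) {i j : Fin (p + 1)} (h : i ≠ j) :
    unitP p q i * star (unitP p q j) + unitP p q j * star (unitP p q i) = 0 := by
  induction i using Fin.cases with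
  | zero =>
    induction j using Fin.cases with
    | zero => exact absurd rfl h
    | succ j => simp [unitP_zero, unitP_succ]
  | succ i =>
    induction j using Fin.cases with
    | zero => simp [unitP_zero, unitP_succ]
    | succ j =>
      have hij : Fin.castAdd q i ≠ Fin.castAdd q j := fun e => h (by simpa using e)
      have := gen_mul_gen_of_ne hij
      simp only [unitP_succ, star_gen, mul_neg]
      rw [← neg_add, this, neg_zero]

/-- Averaging the double sum with its transpose cancels the off-diagonal terms. With `X i j` the
second derivatives this is `D D̄ = Δ`; in the regularity proof `X i j` are integrals instead, so no
second derivative is needed. -/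
theorem sum_sum_mul_of_symm {n : ℕ} {ι : Type*} [Fintype ι] [DecidableEq ι] {c : ι → ι → Cl n}
    (h1 : ∀ i, c i i = 1) (h2 : ∀ i j, i ≠ j → c i j + c j i = 0) {X : ι → ι → Cl n}
    (hX : ∀ i j, X i j = X j i) : ∑ i, ∑ j, c i j * X i j = ∑ i, X i i := by
  have key : (2 : ℝ) • ∑ i, ∑ j, c i j * X i j = (2 : ℝ) • ∑ i, X i i := by
    calc (2 : ℝ) • ∑ i, ∑ j, c i j * X i j
        = ∑ i, ∑ j, c i j * X i j + ∑ i, ∑ j, c j i * X i j := by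
          rw [two_smul]
          congr 1
          rw [Finset.sum_comm]
          exact Finset.sum_congr rfl fun i _ => Finset.sum_congr rfl fun j _ => by rw [hX]
      _ = ∑ i, ∑ j, (c i j + c j i) * X i j := by
          simp only [add_mul, Finset.sum_add_distrib]
      _ = ∑ i, ∑ j, if i = j then (2 : ℝ) • X i j else 0 := by
          refine Finset.sum_congr rfl fun i _ => Finset.sum_congr rfl fun j _ => ?_
          split_ifs with hij
          · subst hij; rw [h1, add_mul, one_mul, two_smul]
          · rw [h2 i j hij, zero_mul]
      _ = (2 : ℝ) • ∑ i, X i i := by simp [Finset.smul_sum]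
  exact smul_right_injective _ two_ne_zero key

theorem sum_star_unitP_mul_unitP (p q : ℕ) {X : Fin (p + 1) → Fin (p + 1) → Cl (p + q)}
    (hX : ∀ i j, X i j = X j i) :
    ∑ i, star (unitP p q i) * ∑ j, unitP p q j * X i j = ∑ i, X i i := by
  rw [← sum_sum_mul_of_symm (c := fun i j => star (unitP p q i) * unitP p q j)
    (star_unitP_mul_self p q) (fun i j h => star_unitP_mul_of_ne p q h) hX]
  simp only [Finset.mul_sum, mul_assoc]

theorem sum_unitP_mul_star_unitP (p q : ℕ) {X : Fin (p + 1) → Fin (p + 1) → Cl (p + q)}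
    (hX : ∀ i j, X i j = X j i) :
    ∑ i, unitP p q i * ∑ j, star (unitP p q j) * X i j = ∑ i, X i i := by
  rw [← sum_sum_mul_of_symm (c := fun i j => unitP p q i * star (unitP p q j))
    (unitP_mul_star_self p q) (fun i j h => unitP_mul_star_of_ne p q h) hX]
  simp only [Finset.mul_sum, mul_assoc]

theorem star_embP {p : ℕ} (q : ℕ) (a : RP p) :
    star (embP q a) = ∑ i, a i • star (unitP p q i) := by
  simp [embP, CliffordAlgebra.star_smul]

theorem embQ_eq_ι {p q : ℕ} (b : RQ q) :
    embQ p b = CliffordAlgebra.ι (negForm (p + q)) (∑ j, b j • Pi.single (Fin.natAdd p j) 1) := by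
  simp [embQ, unitQ, gen]

theorem embQ_smul {p q : ℕ} (r : ℝ) (b : RQ q) : embQ p (r • b) = r • embQ p b := by
  simp [embQ, Finset.smul_sum, smul_smul]

theorem embQ_neg {p q : ℕ} (b : RQ q) : embQ p (-b) = -embQ p b := by
  simp [embQ]

theorem star_embQ {p q : ℕ} (b : RQ q) : star (embQ p b) = -embQ p b := by
  rw [embQ_eq_ι, CliffordAlgebra.star_ι]

theorem embQ_mul_self {p q : ℕ} (b : RQ q) : embQ p b * embQ p b = -(‖b‖ ^ 2) • 1 := by
  rw [embQ_eq_ι, CliffordAlgebra.ι_sq_scalar, negForm_apply, Algebra.algebraMap_eq_smul_one]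
  congr 2
  rw [EuclideanSpace.norm_sq_eq, Fin.sum_univ_add]
  have h1 : ∀ i : Fin p, (∑ j, b j • (Pi.single (Fin.natAdd p j) 1 : Fin (p + q) → ℝ))
      (Fin.castAdd q i) = 0 := by
    intro i
    rw [Finset.sum_apply]
    refine Finset.sum_eq_zero fun j _ => ?_
    have : Fin.castAdd q i ≠ Fin.natAdd p j := by
      intro e
      have := congrArg Fin.val e
      simp at this
      omega
    simp [this]
  have h2 : ∀ i : Fin q, (∑ j, b j • (Pi.single (Fin.natAdd p j) 1 : Fin (p + q) → ℝ))
      (Fin.natAdd p i) = b i := by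
    intro i
    rw [Finset.sum_apply, Finset.sum_eq_single i]
    · simp
    · intro j _ hj
      have : Fin.natAdd p i ≠ Fin.natAdd p j := fun e => hj (by simpa using e.symm)
      simp [this]
    · simp
  simp only [h1, h2]
  simp

theorem star_emb {p q : ℕ} (x : RPQ p q) :
    star (emb x) = star (embP q x.fst) - embQ p x.snd := by
  rw [emb, star_add, star_embQ, sub_eq_add_neg]

theorem ringInverse_embQ {p q : ℕ} {b : RQ q} (hb : b ≠ 0) :
    Ring.inverse (embQ p b) = -(‖b‖ ^ 2)⁻¹ • embQ p b := by
  have hn : ‖b‖ ^ 2 ≠ 0 := pow_ne_zero 2 (norm_ne_zero_iff.2 hb)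
  have h1 : embQ p b * (-(‖b‖ ^ 2)⁻¹ • embQ p b) = 1 := by
    rw [mul_smul_comm, embQ_mul_self, smul_smul, neg_mul_neg, inv_mul_cancel₀ hn, one_smul]
  have h2 : (-(‖b‖ ^ 2)⁻¹ • embQ p b) * embQ p b = 1 := by
    rw [smul_mul_assoc, embQ_mul_self, smul_smul, neg_mul_neg, inv_mul_cancel₀ hn, one_smul]
  exact Ring.inverse_unit (⟨embQ p b, -(‖b‖ ^ 2)⁻¹ • embQ p b, h1, h2⟩ : (Cl (p + q))ˣ)

theorem embQ_mul_embQ_of_mem_sph {p q : ℕ} {ω : RQ q} (hω : ω ∈ sph q) (c : Cl (p + q)) :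
    embQ p ω * (embQ p ω * c) = -c := by
  have : ‖ω‖ = 1 := by simpa [sph] using hω
  rw [← mul_assoc, embQ_mul_self, this]
  simp

theorem neg_mem_sph {q : ℕ} {ω : RQ q} (hω : ω ∈ sph q) : -ω ∈ sph q := by
  simpa [sph] using hω

end PartialSlice

end

noncomputable section

namespace PartialSlice

open MeasureTheory Filter Topology
open scoped ContDiff Convolution

/-! ### Interior regularity -/

section General

variable {E F : Type*} [NormedAddCommGroup E] [NormedSpace ℝ E]
  [NormedAddCommGroup F] [NormedSpace ℝ F]

theorem fderiv_fderiv_comm {f : E → F} {x : E} (hf : ContDiffAt ℝ 2 f x) (v w : E) :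
    fderiv ℝ (fun z => fderiv ℝ f z v) x w = fderiv ℝ (fun z => fderiv ℝ f z w) x v := by
  have hd : DifferentiableAt ℝ (fderiv ℝ f) x :=
    (hf.fderiv_right (m := 1) (by norm_num)).differentiableAt one_ne_zero
  have h : ∀ v w, fderiv ℝ (fun z => fderiv ℝ f z v) x w = fderiv ℝ (fderiv ℝ f) x w v := by
    intro v w
    rw [fderiv_clm_apply hd (differentiableAt_const v)]
    simp
  rw [h, h]
  exact (hf.isSymmSndFDerivAt (by simp)).eq w v

theorem exists_contDiff_hasCompactSupport_eventuallyEq [FiniteDimensional ℝ E] {D : Set E}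
    (hD : IsOpen D) {n : ℕ∞} {g : E → F} (hg : ContDiffOn ℝ n g D) {x : E} (hx : x ∈ D) :
    ∃ g' : E → F, ContDiff ℝ n g' ∧ HasCompactSupport g' ∧ g' =ᶠ[𝓝 x] g := by
  obtain ⟨ε, hε, hball⟩ := Metric.nhds_basis_closedBall.mem_iff.1 (hD.mem_nhds hx)
  let f : ContDiffBump x := ⟨ε / 2, ε, half_pos hε, half_lt_self hε⟩
  refine ⟨fun y => f y • g y, contDiff_iff_contDiffAt.2 fun y => ?_,
    f.hasCompactSupport.smul_right, ?_⟩
  · by_cases hy : y ∈ Metric.closedBall x ε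
    · exact f.contDiffAt.smul (hg.contDiffAt (hD.mem_nhds (hball hy)))
    · refine (contDiffAt_const (c := (0 : F))).congr_of_eventuallyEq ?_
      filter_upwards [Metric.isClosed_closedBall.isOpen_compl.mem_nhds hy] with z hz
      rw [f.zero_of_le_dist (not_le.1 (Metric.mem_closedBall.not.1 hz)).le, zero_smul]
  · filter_upwards [f.eventuallyEq_one] with y hy
    rw [hy]
    simp

variable [MeasurableSpace E] [BorelSpace E] {μ : Measure E}

theorem integrable_smul_of_hasCompactSupport {E : Type*} [NormedAddCommGroup E] [MeasurableSpace E]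
    [BorelSpace E] {μ : Measure E} [IsFiniteMeasureOnCompacts μ] {a : E → ℝ} {b : E → F}
    (ha : Continuous a) (hs : HasCompactSupport a) (hb : Continuous b) :
    Integrable (fun y => a y • b y) μ :=
  (ha.smul hb).integrable_of_hasCompactSupport hs.smul_right

/-- Weak form of the symmetry of second derivatives for a merely `C¹` function `K`: integration by
parts puts both derivatives on the test function `Ψ`, where they commute. -/
theorem integral_fderiv_smul_fderiv_comm [FiniteDimensional ℝ E] [μ.IsAddHaarMeasure]
    {Ψ : E → ℝ} {K : E → F} (hΨ : ContDiff ℝ ∞ Ψ) (hs : HasCompactSupport Ψ)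
    (hK : ContDiff ℝ 1 K) (v w : E) :
    ∫ y, fderiv ℝ Ψ y v • fderiv ℝ K y w ∂μ = ∫ y, fderiv ℝ Ψ y w • fderiv ℝ K y v ∂μ := by
  have h1 : ∀ v, ContDiff ℝ ∞ (fun y => fderiv ℝ Ψ y v) := fun v =>
    (hΨ.fderiv_right (m := ∞) (by simp)).clm_apply contDiff_const
  have s1 : ∀ v, HasCompactSupport (fun y => fderiv ℝ Ψ y v) := fun v => hs.fderiv_apply ℝ v
  have h2 : ∀ v w, Continuous (fun y => fderiv ℝ (fun z => fderiv ℝ Ψ z v) y w) := fun v w =>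
    ((h1 v).continuous_fderiv (by simp)).clm_apply continuous_const
  have k1 : ∀ v, Continuous (fun y => fderiv ℝ K y v) := fun v =>
    (hK.continuous_fderiv one_ne_zero).clm_apply continuous_const
  have key : ∀ v w, ∫ y, fderiv ℝ Ψ y v • fderiv ℝ K y w ∂μ
      = -∫ y, fderiv ℝ (fun z => fderiv ℝ Ψ z v) y w • K y ∂μ := by
    intro v w
    refine integral_smul_fderiv_eq_neg_fderiv_smul_of_integrable ?_ ?_ ?_ ?_ ?_
    · exact integrable_smul_of_hasCompactSupport (h2 v w) ((s1 v).fderiv_apply ℝ w) hK.continuous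
    · exact integrable_smul_of_hasCompactSupport (h1 v).continuous (s1 v) (k1 w)
    · exact integrable_smul_of_hasCompactSupport (h1 v).continuous (s1 v) hK.continuous
    · exact fun y _ => ((h1 v).differentiable (by simp)) y
    · exact fun y _ => (hK.differentiable one_ne_zero) y
  rw [key v w, key w v]
  congr 2
  ext y
  rw [fderiv_fderiv_comm (hΨ.contDiffAt.of_le (WithTop.coe_le_coe.2 le_top)) v w]

theorem integral_fderiv_smul_fderiv_affine_comm [FiniteDimensional ℝ E] [μ.IsAddHaarMeasure]
    {Ψ : E → ℝ} {G : E → F} (hΨ : ContDiff ℝ ∞ Ψ) (hs : HasCompactSupport Ψ)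
    (hG : ContDiff ℝ 1 G) (x : E) (t : ℝ) (v w : E) :
    ∫ y, fderiv ℝ Ψ y v • fderiv ℝ G (x - t • y) w ∂μ
      = ∫ y, fderiv ℝ Ψ y w • fderiv ℝ G (x - t • y) v ∂μ := by
  rcases eq_or_ne t 0 with rfl | ht
  -- At `t = 0` the substitution `y ↦ x - t y` degenerates, but then the derivative of `G` is a
  -- constant and both sides vanish because `∫ ∂_v Ψ = 0`.
  · have key : ∀ v c, ∫ y, fderiv ℝ Ψ y v • (c : F) ∂μ = 0 := by
      intro v c
      have := integral_smul_fderiv_eq_neg_fderiv_smul_of_integrable (μ := μ) (f := Ψ)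
        (g := fun _ : E => c) (v := v) ?_ ?_ ?_ ?_ ?_
      · simpa using this
      · exact integrable_smul_of_hasCompactSupport
          ((hΨ.continuous_fderiv (by simp)).clm_apply continuous_const)
          (hs.fderiv_apply ℝ v) continuous_const
      · simp
      · exact integrable_smul_of_hasCompactSupport hΨ.continuous hs continuous_const
      · exact fun y _ => hΨ.differentiable (by simp) y
      · exact fun y _ => differentiableAt_const _
    simp only [zero_smul, sub_zero, key]
  · have hK : ContDiff ℝ 1 (fun y => G (x - t • y)) :=
      hG.comp (contDiff_const.sub (contDiff_const.smul contDiff_id))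
    have hd : ∀ y w, fderiv ℝ (fun y => G (x - t • y)) y w = -t • fderiv ℝ G (x - t • y) w := by
      intro y w
      have h1 : HasFDerivAt (fun y : E => x - t • y) (-(t • ContinuousLinearMap.id ℝ E)) y := by
        simpa using ((hasFDerivAt_id y).const_smul t).const_sub x
      have h2 := ((hG.differentiable one_ne_zero) (x - t • y)).hasFDerivAt.comp y h1
      have h3 : fderiv ℝ (fun y => G (x - t • y)) y = _ := h2.fderiv
      rw [h3]
      simp
    have := integral_fderiv_smul_fderiv_comm (μ := μ) hΨ hs hK v w
    simp only [hd, smul_comm _ (-t), integral_smul] at this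
    exact smul_right_injective _ (neg_ne_zero.2 ht) this

theorem hasDerivAt_integral_smul_dilation [FiniteDimensional ℝ E] [μ.IsAddHaarMeasure]
    {φ : E → ℝ} {G : E → F} (hφ : Continuous φ) (hs : HasCompactSupport φ)
    (hG : ContDiff ℝ 1 G) (hGs : HasCompactSupport G) (x : E) (t : ℝ) :
    HasDerivAt (fun t : ℝ => ∫ y, φ y • G (x - t • y) ∂μ)
      (∫ y, φ y • fderiv ℝ G (x - t • y) (-y) ∂μ) t := by
  have hG' := hG.continuous_fderiv one_ne_zero
  obtain ⟨C, hC⟩ := hG'.bounded_above_of_compact_support (hGs.fderiv ℝ)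
  have hc1 : ∀ t : ℝ, Continuous (fun y => x - t • y) := fun t => by fun_prop
  refine (hasDerivAt_integral_of_dominated_loc_of_deriv_le (μ := μ) (s := Set.univ)
    (F := fun (t : ℝ) y => φ y • G (x - t • y))
    (F' := fun (t : ℝ) y => φ y • fderiv ℝ G (x - t • y) (-y))
    (bound := fun y => ‖φ y‖ * (C * ‖y‖)) (x₀ := t) univ_mem ?_ ?_ ?_ ?_ ?_ ?_).2
  · exact Eventually.of_forall fun s =>
      (integrable_smul_of_hasCompactSupport hφ hs
        (hG.continuous.comp (hc1 s))).aestronglyMeasurable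
  · exact integrable_smul_of_hasCompactSupport hφ hs (hG.continuous.comp (hc1 t))
  · exact (integrable_smul_of_hasCompactSupport hφ hs
      ((hG'.comp (hc1 t)).clm_apply continuous_neg)).aestronglyMeasurable
  · refine Eventually.of_forall fun y s _ => ?_
    rw [norm_smul]
    gcongr
    calc ‖fderiv ℝ G (x - s • y) (-y)‖ ≤ ‖fderiv ℝ G (x - s • y)‖ * ‖-y‖ :=
          ContinuousLinearMap.le_opNorm _ _
      _ ≤ C * ‖y‖ := by rw [norm_neg]; gcongr; exact hC _
  · exact integrable_smul_of_hasCompactSupport (F := ℝ) hφ.norm hs.norm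
      (continuous_const.mul continuous_norm)
  · refine Eventually.of_forall fun y s _ => ?_
    refine HasDerivAt.const_smul (φ y) ?_
    have h1 : HasDerivAt (fun s : ℝ => x - s • y) (-y) s := by
      simpa using ((hasDerivAt_id s).smul_const y).const_sub x
    exact ((hG.differentiable one_ne_zero) (x - s • y)).hasFDerivAt.comp_hasDerivAt s h1

end General

/-! ### A radial kernel -/

/-- The `i`-th coordinate vector of `ℝ^{p+2}`. -/
def eX {p : ℕ} (i : Fin (p + 1)) : RP p × ℝ := (EuclideanSpace.single i 1, 0)

/-- The last coordinate vector of `ℝ^{p+2}`. -/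
def eR {p : ℕ} : RP p × ℝ := (0, 1)

theorem eq_sum_coord {p : ℕ} (y : RP p × ℝ) : y = ∑ i, y.1 i • eX i + y.2 • eR := by
  refine Prod.ext ?_ ?_
  · ext j
    simp [eX, eR, Prod.fst_sum, Finset.sum_apply, Pi.single_apply]
  · simp [eX, eR, Prod.snd_sum]

theorem map_eq_sum_coord {p : ℕ} {F : Type*} [NormedAddCommGroup F] [NormedSpace ℝ F]
    (L : RP p × ℝ →L[ℝ] F) (y : RP p × ℝ) : L y = ∑ i, y.1 i • L (eX i) + y.2 • L eR := by
  conv_lhs => rw [eq_sum_coord y]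
  simp

instance instIsAddHaarMeasureProd (p : ℕ) : (volume : Measure (RP p × ℝ)).IsAddHaarMeasure :=
  Measure.prod.instIsAddHaarMeasure _ _

/-- With `η(s) = exp(-1/s)` for `s > 0` and `N = ε² - |y|²`, take `Ψ = η(N)` and `φ = η'(N)`. Then
`∇Ψ = -2 φ(y) y`, which turns the dilation derivative of an average against `φ` into a Dirichlet
pairing with `Ψ`. -/
theorem exists_radial_kernel (p : ℕ) {ε : ℝ} (hε : 0 < ε) :
    ∃ Ψ φ : RP p × ℝ → ℝ, ContDiff ℝ ∞ Ψ ∧ HasCompactSupport Ψ ∧ ContDiff ℝ ∞ φ ∧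
      HasCompactSupport φ ∧ (∀ y, φ y ≠ 0 → ‖y‖ < ε) ∧ ∫ y, φ y ≠ 0 ∧
      (∀ y i, fderiv ℝ Ψ y (eX i) = -2 * (φ y * y.1 i)) ∧
      ∀ y, fderiv ℝ Ψ y eR = -2 * (φ y * y.2) := by
  let N : RP p × ℝ → ℝ := fun y => ε ^ 2 - (‖y.1‖ ^ 2 + y.2 ^ 2)
  have hN : ContDiff ℝ ∞ N :=
    contDiff_const.sub ((contDiff_fst.norm_sq ℝ).add (contDiff_snd.pow 2))
  -- This is `η'(s) = s⁻² η(s)`, written as a polynomial in `s⁻¹` times `η` so that its smoothness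
  -- across `0` is available.
  let k : ℝ → ℝ := fun s => (Polynomial.X ^ 2 : Polynomial ℝ).eval s⁻¹ * expNegInvGlue s
  have hk : ContDiff ℝ ∞ k := expNegInvGlue.contDiff_polynomial_eval_inv_mul _
  have hd : ∀ s, HasDerivAt expNegInvGlue (k s) s := by
    intro s
    have := expNegInvGlue.hasDerivAt_polynomial_eval_inv_mul 1 s
    simpa [k] using this
  -- The norm of the product is the maximum norm, whereas `N` uses the Euclidean one; the former is
  -- dominated by the latter.
  have hbd : ∀ y, 0 < N y → ‖y‖ < ε := by
    intro y hy
    have h1 : ‖y.1‖ ^ 2 + y.2 ^ 2 < ε ^ 2 := by simpa [N] using hy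
    rw [Prod.norm_def]
    refine max_lt ?_ ?_
    · exact lt_of_pow_lt_pow_left₀ 2 hε.le (by nlinarith [sq_nonneg y.2])
    · refine lt_of_pow_lt_pow_left₀ 2 hε.le ?_
      rw [Real.norm_eq_abs, sq_abs]
      nlinarith [sq_nonneg ‖y.1‖]
  have hk0 : ∀ s, s ≤ 0 → k s = 0 := fun s hs => by simp [k, expNegInvGlue.zero_of_nonpos hs]
  have hkpos : ∀ s, 0 ≤ k s := fun s => by
    have := expNegInvGlue.nonneg s
    simp only [k, Polynomial.eval_pow, Polynomial.eval_X]
    positivity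
  have hcs : ∀ h : ℝ → ℝ, (∀ s, s ≤ 0 → h s = 0) → HasCompactSupport (fun y => h (N y)) := by
    intro h h0
    refine HasCompactSupport.intro (isCompact_closedBall (0 : RP p × ℝ) ε) fun y hy => ?_
    refine h0 _ (not_lt.1 fun hlt => hy ?_)
    simpa using (hbd y hlt).le
  have hNd : ∀ y v, fderiv ℝ N y v = -2 * (inner ℝ y.1 v.1 + y.2 * v.2) := by
    intro y v
    have h1 : HasFDerivAt N _ y := ((hasFDerivAt_fst (p := y)).norm_sq.add
      ((hasFDerivAt_snd (p := y)).pow 2)).const_sub (ε ^ 2)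
    rw [h1.fderiv]
    simp
    ring
  have hΨd : ∀ y v, fderiv ℝ (fun y => expNegInvGlue (N y)) y v
      = -2 * (k (N y) * (inner ℝ y.1 v.1 + y.2 * v.2)) := by
    intro y v
    have h1 := (hd (N y)).comp_hasFDerivAt y (hN.differentiable (by simp) y).hasFDerivAt
    have h2 : fderiv ℝ (fun y => expNegInvGlue (N y)) y = _ := h1.fderiv
    rw [h2, smul_apply, hNd, smul_eq_mul]
    ring
  have hφ : Continuous (fun y => k (N y)) := hk.continuous.comp hN.continuous
  refine ⟨fun y => expNegInvGlue (N y), fun y => k (N y), expNegInvGlue.contDiff.comp hN,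
    hcs _ fun s hs => expNegInvGlue.zero_of_nonpos hs, hk.comp hN, hcs _ hk0, ?_, ?_, ?_, ?_⟩
  · exact fun y hy => hbd y (not_le.1 fun hle => hy (hk0 _ hle))
  · refine (hφ.integral_pos_of_hasCompactSupport_nonneg_nonzero (hcs _ hk0)
      (fun y => hkpos _) (x := 0) ?_).ne'
    have : 0 < N 0 := by simp [N]; positivity
    have h2 := expNegInvGlue.pos_of_pos this
    simp only [k, Polynomial.eval_pow, Polynomial.eval_X]
    positivity
  · intro y i
    rw [hΨd]
    simp [eX, EuclideanSpace.inner_single_right]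
  · intro y
    rw [hΨd]
    simp [eR]

/-- Mean value property. The function `t ↦ ∫ φ(y) G(x - t y)` has derivative `½ ∫ ∇Ψ(y) · ∇G(x - t
y)`, because `-φ(y) y = ½ ∇Ψ(y)`. The hypothesis `h` says that this vanishes, so the values at `t =
1` and `t = 0` agree. -/
theorem integral_kernel_smul_eq {p : ℕ} {F : Type*} [NormedAddCommGroup F] [NormedSpace ℝ F]
    [CompleteSpace F] {Ψ φ : RP p × ℝ → ℝ} (hΨ : ContDiff ℝ ∞ Ψ) (hΨs : HasCompactSupport Ψ)
    (hφ : ContDiff ℝ ∞ φ) (hφs : HasCompactSupport φ)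
    (hX : ∀ y i, fderiv ℝ Ψ y (eX i) = -2 * (φ y * y.1 i))
    (hR : ∀ y, fderiv ℝ Ψ y eR = -2 * (φ y * y.2)) {G : RP p × ℝ → F}
    (hG : ContDiff ℝ 1 G) (hGs : HasCompactSupport G) (x : RP p × ℝ)
    (h : ∀ t ∈ Set.Icc (0 : ℝ) 1, (∑ i, ∫ y, fderiv ℝ Ψ y (eX i) • fderiv ℝ G (x - t • y) (eX i))
      + ∫ y, fderiv ℝ Ψ y eR • fderiv ℝ G (x - t • y) eR = 0) :
    ∫ y, φ y • G (x - y) = (∫ y, φ y) • G x := by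
  have hd := hasDerivAt_integral_smul_dilation (μ := volume) hφ.continuous hφs hG hGs x
  have hG' := hG.continuous_fderiv one_ne_zero
  have hint : ∀ (t : ℝ) v w, Integrable
      (fun y => fderiv ℝ Ψ y v • fderiv ℝ G (x - t • y) w) := fun t v w =>
    integrable_smul_of_hasCompactSupport
      ((hΨ.continuous_fderiv (by simp)).clm_apply continuous_const) (hΨs.fderiv_apply ℝ v)
      ((hG'.comp (by fun_prop)).clm_apply continuous_const)
  have hz : ∀ t ∈ Set.Icc (0 : ℝ) 1, ∫ y, φ y • fderiv ℝ G (x - t • y) (-y) = 0 := by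
    intro t ht
    have e : ∀ y, φ y • fderiv ℝ G (x - t • y) (-y) = (1 / 2 : ℝ) •
        (∑ i, fderiv ℝ Ψ y (eX i) • fderiv ℝ G (x - t • y) (eX i)
          + fderiv ℝ Ψ y eR • fderiv ℝ G (x - t • y) eR) := by
      intro y
      rw [map_neg, map_eq_sum_coord]
      simp only [hX, hR, smul_add, smul_neg, Finset.smul_sum, smul_smul, neg_add,
        ← Finset.sum_neg_distrib]
      congr 1
      · refine Finset.sum_congr rfl fun i _ => ?_
        rw [← neg_smul]; congr 1; ring
      · rw [← neg_smul]; congr 1; ring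
    simp only [e]
    rw [integral_smul, integral_add (integrable_finsetSum _ fun i _ => hint t _ _) (hint t _ _),
      integral_finsetSum _ fun i _ => hint t _ _, h t ht, smul_zero]
  have := constant_of_has_deriv_right_zero (a := (0 : ℝ)) (b := 1)
    (f := fun t : ℝ => ∫ y, φ y • G (x - t • y)) (fun t _ => (hd t).continuousAt.continuousWithinAt)
    (fun t ht => by
      have := (hd t).hasDerivWithinAt (s := Set.Ici t)
      rwa [hz t ⟨ht.1, ht.2.le⟩] at this) 1 ⟨zero_le_one, le_rfl⟩
  simpa [integral_smul_const] using this

/-- A pair of `C¹` solutions of the generalized Cauchy-Riemann equations is smooth. -/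
theorem contDiffOn_of_cauchyRiemann {p q : ℕ} {D : Set (RP p × ℝ)} (hD : IsOpen D)
    {F₁ F₂ : RP p × ℝ → Cl (p + q)} (h1 : ContDiffOn ℝ 1 F₁ D) (h2 : ContDiffOn ℝ 1 F₂ D)
    (hCR : ∀ y ∈ D, dirac F₁ y - dR F₂ y = 0 ∧ diracBar F₂ y + dR F₁ y = 0) :
    ContDiffOn ℝ ∞ F₁ D ∧ ContDiffOn ℝ ∞ F₂ D := by
  suffices H : ∀ x₀ ∈ D, ContDiffAt ℝ ∞ F₁ x₀ ∧ ContDiffAt ℝ ∞ F₂ x₀ from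
    ⟨fun x hx => (H x hx).1.contDiffWithinAt, fun x hx => (H x hx).2.contDiffWithinAt⟩
  intro x₀ hx₀
  obtain ⟨G₁, hG₁, hs₁, he₁⟩ := exists_contDiff_hasCompactSupport_eventuallyEq hD
    (n := 1) (by exact_mod_cast h1) hx₀
  obtain ⟨G₂, hG₂, hs₂, he₂⟩ := exists_contDiff_hasCompactSupport_eventuallyEq hD
    (n := 1) (by exact_mod_cast h2) hx₀
  replace hG₁ : ContDiff ℝ 1 G₁ := by exact_mod_cast hG₁
  replace hG₂ : ContDiff ℝ 1 G₂ := by exact_mod_cast hG₂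
  -- The cut-off functions satisfy the Cauchy-Riemann equations only near `x₀`, say on a ball of
  -- radius `δ`. A kernel supported within `δ / 2` and centres `x` within `δ / 2` of `x₀` keep every
  -- `x - t y` with `0 ≤ t ≤ 1` in that ball.
  have hev : ∀ᶠ x in 𝓝 x₀, dirac G₁ x = dR G₂ x ∧ diracBar G₂ x = -dR G₁ x := by
    filter_upwards [he₁.eventuallyEq_nhds, he₂.eventuallyEq_nhds, hD.mem_nhds hx₀]
      with x e₁ e₂ hx
    have := hCR x hx
    simp only [dirac, diracBar, dX, dR, e₁.fderiv_eq, e₂.fderiv_eq] at this ⊢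
    exact ⟨sub_eq_zero.1 this.1, eq_neg_of_add_eq_zero_left this.2⟩
  obtain ⟨δ, hδ, hball⟩ := Metric.eventually_nhds_iff_ball.1 hev
  obtain ⟨Ψ, φ, hΨ, hΨs, hφ, hφs, hsupp, hne, hX, hR⟩ := exists_radial_kernel p (half_pos hδ)
  have hmem : ∀ x ∈ Metric.ball x₀ (δ / 2), ∀ t ∈ Set.Icc (0 : ℝ) 1, ∀ y, φ y ≠ 0 →
      x - t • y ∈ Metric.ball x₀ δ := by
    intro x hx t ht y hy
    rw [Metric.mem_ball, dist_eq_norm] at hx ⊢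
    have h3 : ‖t • y‖ ≤ ‖y‖ := by
      rw [norm_smul, Real.norm_eq_abs, abs_of_nonneg ht.1]
      exact mul_le_of_le_one_left (norm_nonneg _) ht.2
    calc ‖x - t • y - x₀‖ = ‖(x - x₀) - t • y‖ := by congr 1; abel
      _ ≤ ‖x - x₀‖ + ‖t • y‖ := norm_sub_le _ _
      _ < δ / 2 + δ / 2 := add_lt_add_of_lt_of_le hx (h3.trans (hsupp y hy).le)
      _ = δ := add_halves δ
  have hΨ0 : ∀ y, φ y = 0 → fderiv ℝ Ψ y eR = 0 ∧ ∀ i, fderiv ℝ Ψ y (eX i) = 0 := by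
    intro y hy
    simp [hX, hR, hy]
  have hint : ∀ {G : RP p × ℝ → Cl (p + q)}, ContDiff ℝ 1 G → ∀ (x : RP p × ℝ) (t : ℝ) v w,
      Integrable (fun y => fderiv ℝ Ψ y v • fderiv ℝ G (x - t • y) w) := fun hG x t v w =>
    integrable_smul_of_hasCompactSupport
      ((hΨ.continuous_fderiv (by simp)).clm_apply continuous_const) (hΨs.fderiv_apply ℝ v)
      (((hG.continuous_fderiv one_ne_zero).comp (by fun_prop)).clm_apply continuous_const)
  have hpull : ∀ {G : RP p × ℝ → Cl (p + q)}, ContDiff ℝ 1 G → ∀ (x : RP p × ℝ) (t : ℝ) v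
      (c : Fin (p + 1) → Cl (p + q)),
      ∑ j, c j * ∫ y, fderiv ℝ Ψ y v • fderiv ℝ G (x - t • y) (eX j)
        = ∫ y, fderiv ℝ Ψ y v • ∑ j, c j * dX j G (x - t • y) := by
    intro G hG x t v c
    simp only [Finset.smul_sum]
    have e : ∀ j y, fderiv ℝ Ψ y v • (c j * dX j G (x - t • y))
        = mulL (c j) (fderiv ℝ Ψ y v • fderiv ℝ G (x - t • y) (eX j)) := by
      intro j y
      rw [map_smul]
      rfl
    simp only [e]
    rw [integral_finsetSum _ fun j _ => (mulL (c j)).integrable_comp (hint hG x t v _)]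
    refine Finset.sum_congr rfl fun j _ => ?_
    rw [(mulL (c j)).integral_comp_comm (hint hG x t v _)]
    rfl
  have hint_neg : ∀ {G : RP p × ℝ → Cl (p + q)} (x : RP p × ℝ) (t : ℝ) v w,
      ∫ y, fderiv ℝ Ψ y v • -fderiv ℝ G (x - t • y) w
        = -∫ y, fderiv ℝ Ψ y v • fderiv ℝ G (x - t • y) w := by
    intro G x t v w
    simp only [smul_neg, integral_neg]
  -- The equation is used only where `φ y ≠ 0`; elsewhere the derivative of `Ψ` vanishes and both
  -- integrands are zero.
  have hdirac : ∀ x ∈ Metric.ball x₀ (δ / 2), ∀ t ∈ Set.Icc (0 : ℝ) 1, ∀ v : RP p × ℝ,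
      (∀ y, φ y = 0 → fderiv ℝ Ψ y v = 0) →
      ∑ j, unitP p q j * ∫ y, fderiv ℝ Ψ y v • fderiv ℝ G₁ (x - t • y) (eX j)
        = ∫ y, fderiv ℝ Ψ y v • fderiv ℝ G₂ (x - t • y) eR := by
    intro x hx t ht v hv
    rw [hpull hG₁]
    refine integral_congr_ae (Eventually.of_forall fun y => ?_)
    by_cases hy : φ y = 0
    · simp [hv y hy]
    · exact congrArg _ (hball _ (hmem x hx t ht y hy)).1
  have hdiracBar : ∀ x ∈ Metric.ball x₀ (δ / 2), ∀ t ∈ Set.Icc (0 : ℝ) 1, ∀ v : RP p × ℝ,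
      (∀ y, φ y = 0 → fderiv ℝ Ψ y v = 0) →
      ∑ j, star (unitP p q j) * ∫ y, fderiv ℝ Ψ y v • fderiv ℝ G₂ (x - t • y) (eX j)
        = -∫ y, fderiv ℝ Ψ y v • fderiv ℝ G₁ (x - t • y) eR := by
    intro x hx t ht v hv
    rw [hpull hG₂, ← hint_neg]
    refine integral_congr_ae (Eventually.of_forall fun y => ?_)
    by_cases hy : φ y = 0
    · simp [hv y hy]
    · exact congrArg _ (hball _ (hmem x hx t ht y hy)).2
  have hswap := fun {G : RP p × ℝ → Cl (p + q)} (hG : ContDiff ℝ 1 G) =>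
    integral_fderiv_smul_fderiv_affine_comm (μ := volume) hΨ hΨs hG
  -- By the mean value property `G` equals `(∫ φ)⁻¹ (φ ⋆ G)` near `x₀`, and a convolution with `φ`
  -- is smooth.
  have hmean : ∀ {G : RP p × ℝ → Cl (p + q)}, ContDiff ℝ 1 G → HasCompactSupport G →
      (∀ x ∈ Metric.ball x₀ (δ / 2), ∀ t ∈ Set.Icc (0 : ℝ) 1,
        (∑ i, ∫ y, fderiv ℝ Ψ y (eX i) • fderiv ℝ G (x - t • y) (eX i))
          + ∫ y, fderiv ℝ Ψ y eR • fderiv ℝ G (x - t • y) eR = 0) → ContDiffAt ℝ ∞ G x₀ := by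
    intro G hG hGs hGh
    have hc : ContDiff ℝ ∞ (φ ⋆[ContinuousLinearMap.lsmul ℝ ℝ, volume] G) :=
      hφs.contDiff_convolution_left _ hφ hG.continuous.locallyIntegrable
    refine (contDiffAt_const (c := (∫ y, φ y)⁻¹)).smul hc.contDiffAt |>.congr_of_eventuallyEq ?_
    filter_upwards [Metric.ball_mem_nhds x₀ (half_pos hδ)] with x hx
    have := integral_kernel_smul_eq hΨ hΨs hφ hφs hX hR hG hGs x (hGh x hx)
    change G x = (∫ y, φ y)⁻¹ • ∫ y, φ y • G (x - y)
    rw [this, smul_smul, inv_mul_cancel₀ hne, one_smul]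
  refine ⟨(hmean hG₁ hs₁ fun x hx t ht => ?_).congr_of_eventuallyEq he₁.symm,
    (hmean hG₂ hs₂ fun x hx t ht => ?_).congr_of_eventuallyEq he₂.symm⟩
  -- Weak version of `Δ_{x_p} F₁ = D̄ D F₁ = D̄ ∂_r F₂ = ∂_r D̄ F₂ = -∂_r² F₁`. The weak symmetry
  -- `hswap` replaces each exchange of derivatives.
  · rw [← sum_star_unitP_mul_unitP p q (X := fun i j =>
      ∫ y, fderiv ℝ Ψ y (eX i) • fderiv ℝ G₁ (x - t • y) (eX j)) fun i j => hswap hG₁ x t _ _]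
    simp only [fun i => hdirac x hx t ht (eX i) fun y hy => (hΨ0 y hy).2 i]
    simp only [fun i => hswap hG₂ x t (eX i) eR]
    rw [hdiracBar x hx t ht eR fun y hy => (hΨ0 y hy).1, neg_add_cancel]
  · rw [← sum_unitP_mul_star_unitP p q (X := fun i j =>
      ∫ y, fderiv ℝ Ψ y (eX i) • fderiv ℝ G₂ (x - t • y) (eX j)) fun i j => hswap hG₂ x t _ _]
    simp only [fun i => hdiracBar x hx t ht (eX i) fun y hy => (hΨ0 y hy).2 i]
    simp only [fun i => hswap hG₁ x t (eX i) eR, mul_neg, Finset.sum_neg_distrib]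
    rw [hdirac x hx t ht eR fun y hy => (hΨ0 y hy).1, neg_add_cancel]

/-! ### Calculus in the variables `(x_p, r)` -/

section Derivatives

variable {p n : ℕ} {u v : RP p × ℝ → Cl n} {y : RP p × ℝ}

theorem dX_eq (i : Fin (p + 1)) (u : RP p × ℝ → Cl n) (y : RP p × ℝ) :
    dX i u y = fderiv ℝ u y (eX i) := rfl

theorem dR_eq (u : RP p × ℝ → Cl n) (y : RP p × ℝ) : dR u y = fderiv ℝ u y eR := rfl

theorem fderiv_add_apply' (hu : DifferentiableAt ℝ u y) (hv : DifferentiableAt ℝ v y)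
    (e : RP p × ℝ) :
    fderiv ℝ (fun z => u z + v z) y e = fderiv ℝ u y e + fderiv ℝ v y e := by
  rw [fderiv_fun_add hu hv]; rfl

theorem fderiv_mul_left_apply (hu : DifferentiableAt ℝ u y) (c : Cl n) (e : RP p × ℝ) :
    fderiv ℝ (fun z => c * u z) y e = c * fderiv ℝ u y e := by
  have h : HasFDerivAt (fun z => c * u z) ((mulL c).comp (fderiv ℝ u y)) y :=
    (mulL c).hasFDerivAt.comp y hu.hasFDerivAt
  rw [h.fderiv]; rfl

theorem fderiv_smul_apply {s : RP p × ℝ → ℝ} (hs : DifferentiableAt ℝ s y)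
    (hu : DifferentiableAt ℝ u y) (e : RP p × ℝ) :
    fderiv ℝ (fun z => s z • u z) y e = s y • fderiv ℝ u y e + fderiv ℝ s y e • u y := by
  rw [fderiv_fun_smul hs hu]; rfl

theorem fderiv_snd_eX (i : Fin (p + 1)) (y : RP p × ℝ) :
    fderiv ℝ (fun z : RP p × ℝ => z.2) y (eX i) = 0 := by
  rw [fderiv_snd]; rfl

theorem fderiv_snd_eR (y : RP p × ℝ) : fderiv ℝ (fun z : RP p × ℝ => z.2) y eR = 1 := by
  rw [fderiv_snd]; rfl

theorem dX_snd_smul (hu : DifferentiableAt ℝ u y) (i : Fin (p + 1)) :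
    dX i (fun z => z.2 • u z) y = y.2 • dX i u y := by
  rw [dX_eq, fderiv_smul_apply differentiableAt_snd hu, fderiv_snd_eX, zero_smul, add_zero, dX_eq]

theorem dR_snd_smul (hu : DifferentiableAt ℝ u y) :
    dR (fun z => z.2 • u z) y = u y + y.2 • dR u y := by
  rw [dR_eq, fderiv_smul_apply differentiableAt_snd hu, fderiv_snd_eR, one_smul, add_comm, dR_eq]

/-- The Leibniz rule is obtained by expanding `x̄_p` in its real coordinates, which requires only
scalar products and left multiplications by constants. -/
theorem fderiv_conjMul {q : ℕ} {u : RP p × ℝ → Cl (p + q)} (hu : DifferentiableAt ℝ u y)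
    (e : RP p × ℝ) :
    fderiv ℝ (fun z => star (embP q z.1) * u z) y e
      = star (embP q e.1) * u y + star (embP q y.1) * fderiv ℝ u y e := by
  have h0 : (fun z : RP p × ℝ => star (embP q z.1) * u z)
      = fun z => ∑ i, z.1 i • (star (unitP p q i) * u z) := by
    funext z
    simp only [star_embP, Finset.sum_mul, smul_mul_assoc]
  have hm : ∀ i, DifferentiableAt ℝ (fun z => star (unitP p q i) * u z) y := fun i =>
    (mulL (star (unitP p q i))).differentiableAt.comp y hu
  have hc : ∀ i, HasFDerivAt (fun z : RP p × ℝ => z.1 i)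
      ((EuclideanSpace.proj i).comp (ContinuousLinearMap.fst ℝ (RP p) ℝ)) y := fun i =>
    ((EuclideanSpace.proj i).comp (ContinuousLinearMap.fst ℝ (RP p) ℝ)).hasFDerivAt
  have hc' : ∀ i, fderiv ℝ (fun z : RP p × ℝ => z.1 i) y e = e.1 i := fun i => by
    rw [(hc i).fderiv]; rfl
  rw [h0, fderiv_fun_sum fun i _ => (hc i).differentiableAt.fun_smul (hm i)]
  simp only [FunLike.coe_sum, Finset.sum_apply,
    fun i => fderiv_smul_apply (hc i).differentiableAt (hm i) e, hc',
    fderiv_mul_left_apply hu, star_embP, Finset.sum_mul, smul_mul_assoc, Finset.sum_add_distrib]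
  exact add_comm _ _

theorem embP_single (q : ℕ) (i : Fin (p + 1)) :
    embP q (EuclideanSpace.single i (1 : ℝ) : RP p) = unitP p q i := by
  simp [embP]

theorem dX_conjMul {q : ℕ} {u : RP p × ℝ → Cl (p + q)} (hu : DifferentiableAt ℝ u y)
    (i : Fin (p + 1)) : dX i (fun z => star (embP q z.1) * u z) y
      = star (unitP p q i) * u y + star (embP q y.1) * dX i u y := by
  rw [dX_eq, fderiv_conjMul hu, ← dX_eq, eX, embP_single]

theorem dR_conjMul {q : ℕ} {u : RP p × ℝ → Cl (p + q)} (hu : DifferentiableAt ℝ u y) :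
    dR (fun z => star (embP q z.1) * u z) y = star (embP q y.1) * dR u y := by
  rw [dR_eq, fderiv_conjMul hu, ← dR_eq]
  simp [eR, embP]

theorem contDiffOn_conjMul {q : ℕ} {D : Set (RP p × ℝ)} {u : RP p × ℝ → Cl (p + q)} {k : ℕ∞ω}
    (hu : ContDiffOn ℝ k u D) : ContDiffOn ℝ k (fun z => star (embP q z.1) * u z) D := by
  have h0 : (fun z : RP p × ℝ => star (embP q z.1) * u z)
      = fun z => ∑ i, z.1 i • mulL (star (unitP p q i)) (u z) := by
    funext z
    simp only [star_embP, Finset.sum_mul, smul_mul_assoc, mulL_apply]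
  rw [h0]
  refine ContDiffOn.sum fun i _ => ContDiffOn.fun_smul ?_ ?_
  · exact ((EuclideanSpace.proj i : RP p →L[ℝ] ℝ).contDiff.comp contDiff_fst).contDiffOn
  · exact (mulL _).contDiff.comp_contDiffOn hu

theorem contDiffOn_mul_left {D : Set (RP p × ℝ)} {k : ℕ∞ω} (c : Cl n)
    (hu : ContDiffOn ℝ k u D) : ContDiffOn ℝ k (fun z => c * u z) D :=
  (mulL c).contDiff.comp_contDiffOn hu

variable {D : Set (RP p × ℝ)}

theorem dX_congr (hD : IsOpen D) (h : Set.EqOn u v D) (i : Fin (p + 1)) :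
    Set.EqOn (dX i u) (dX i v) D := fun y hy => by
  rw [dX_eq, dX_eq, (h.eventuallyEq_of_mem (hD.mem_nhds hy)).fderiv_eq]

theorem dR_congr (hD : IsOpen D) (h : Set.EqOn u v D) : Set.EqOn (dR u) (dR v) D := fun y hy => by
  rw [dR_eq, dR_eq, (h.eventuallyEq_of_mem (hD.mem_nhds hy)).fderiv_eq]

theorem contDiffOn_fderiv_apply (hD : IsOpen D) (hu : ContDiffOn ℝ ∞ u D) (e : RP p × ℝ) :
    ContDiffOn ℝ ∞ (fun y => fderiv ℝ u y e) D :=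
  (hu.fderiv_of_isOpen hD (by simp)).clm_apply contDiffOn_const

theorem differentiableAt_of_smooth (hD : IsOpen D) (hu : ContDiffOn ℝ ∞ u D) (hy : y ∈ D) :
    DifferentiableAt ℝ u y :=
  (hu.contDiffAt (hD.mem_nhds hy)).differentiableAt (by simp)

theorem fderiv_comm_of_smooth (hD : IsOpen D) (hu : ContDiffOn ℝ ∞ u D) (hy : y ∈ D)
    (e f : RP p × ℝ) :
    fderiv ℝ (fun z => fderiv ℝ u z e) y f = fderiv ℝ (fun z => fderiv ℝ u z f) y e :=
  fderiv_fderiv_comm ((hu.contDiffAt (hD.mem_nhds hy)).of_le (WithTop.coe_le_coe.2 le_top)) e f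

/-- The identity principle used to divide by `r`. -/
theorem eqOn_of_snd_smul_eqOn (hD : IsOpen D) (hu : ContinuousOn u D) (hv : ContinuousOn v D)
    (h : ∀ y ∈ D, y.2 • u y = y.2 • v y) : Set.EqOn u v D := by
  have hne : ∀ y ∈ D, y.2 ≠ 0 → u y = v y := fun y hy h0 =>
    smul_right_injective _ h0 (h y hy)
  intro y hy
  by_cases h0 : y.2 = 0
  · have hlim : Tendsto (fun t : ℝ => (y.1, t)) (𝓝[≠] 0) (𝓝[D] y) := by
      refine tendsto_nhdsWithin_iff.2 ⟨?_, ?_⟩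
      · refine Tendsto.mono_left ?_ nhdsWithin_le_nhds
        have : ContinuousAt (fun t : ℝ => (y.1, t)) 0 := by fun_prop
        rw [ContinuousAt, show (y.1, (0 : ℝ)) = y from Prod.ext rfl h0.symm] at this
        exact this
      · refine Filter.Eventually.filter_mono nhdsWithin_le_nhds ?_
        have : ContinuousAt (fun t : ℝ => (y.1, t)) 0 := by fun_prop
        refine this.eventually_mem (hD.mem_nhds ?_)
        rwa [show (y.1, (0 : ℝ)) = y from Prod.ext rfl h0.symm]
    refine tendsto_nhds_unique_of_eventuallyEq ((hu y hy).tendsto.comp hlim)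
      ((hv y hy).tendsto.comp hlim) ?_
    filter_upwards [self_mem_nhdsWithin, (tendsto_nhdsWithin_iff.1 hlim).2] with t ht htD
    exact hne _ htD ht
  · exact hne y hy h0

end Derivatives

/-! ### Division of odd functions by `r` -/

section Division

variable {p n : ℕ}

/-- The quotient `g / r`, with its limit `∂_r g` at `r = 0`. -/
def divR (g : RP p × ℝ → Cl n) (y : RP p × ℝ) : Cl n :=
  if y.2 = 0 then dR g y else y.2⁻¹ • g y

/-- The integral is the value at `0` of the convolution of the indicator of `(0, 1]` with `s ↦ h
(y.1, -s y.2)`, so smoothness in `y` follows from that of convolutions with a parameter. The cut-off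
`χ`, equal to `1` on `[-1, 1]`, supplies the compact support. -/
theorem contDiff_integral_scale {h : RP p × ℝ → Cl n} (hh : ContDiff ℝ ∞ h) :
    ContDiff ℝ ∞ (fun y : RP p × ℝ => ∫ t in (0 : ℝ)..1, h (y.1, t * y.2)) := by
  let χ : ContDiffBump (0 : ℝ) := ⟨1, 2, one_pos, one_lt_two⟩
  let f : ℝ → ℝ := (Set.Ioc (0 : ℝ) 1).indicator 1
  let g : RP p × ℝ → ℝ → Cl n := fun y s => χ s • h (y.1, -s * y.2)
  have hf : LocallyIntegrable f volume := by
    refine Integrable.locallyIntegrable ?_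
    exact (integrable_indicator_iff measurableSet_Ioc).2 (integrableOn_const (by simp))
  have hg : ContDiff ℝ ∞ (Function.uncurry g) := by
    refine (χ.contDiff.comp contDiff_snd).smul (hh.comp ?_)
    exact (contDiff_fst.comp contDiff_fst).prodMk
      (contDiff_snd.neg.mul (contDiff_snd.comp contDiff_fst))
  have key := contDiffOn_convolution_right_with_param_comp (μ := (volume : Measure ℝ)) (n := ⊤)
    (ContinuousLinearMap.lsmul ℝ ℝ) (s := Set.univ) (v := fun _ : RP p × ℝ => (0 : ℝ))
    contDiffOn_const (f := f) (g := g) isOpen_univ (isCompact_closedBall (0 : ℝ) 2)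
    (fun y s _ hs => by
      have : χ s = 0 := χ.zero_of_le_dist (not_le.1 (Metric.mem_closedBall.not.1 hs)).le
      simp [g, this]) hf hg.contDiffOn
  rw [contDiffOn_univ] at key
  convert key using 2 with y
  rw [intervalIntegral.integral_of_le zero_le_one, ← integral_indicator measurableSet_Ioc]
  refine integral_congr_ae (Eventually.of_forall fun t => ?_)
  by_cases ht : t ∈ Set.Ioc (0 : ℝ) 1
  · have : χ (-t) = 1 := χ.one_of_mem_closedBall (by simpa [abs_of_pos ht.1] using ht.2)
    simp [f, g, ht, this]
  · simp [f, g, ht]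

theorem snd_smul_integral_scale {g : RP p × ℝ → Cl n} (hg : ContDiff ℝ ∞ g) (y : RP p × ℝ) :
    y.2 • ∫ t in (0 : ℝ)..1, dR g (y.1, t * y.2) = g y - g (y.1, 0) := by
  have hd : ∀ t ∈ Set.uIcc (0 : ℝ) 1, HasDerivAt (fun t : ℝ => g (y.1, t * y.2))
      (y.2 • dR g (y.1, t * y.2)) t := by
    intro t _
    have h1 : HasDerivAt (fun t : ℝ => (y.1, t * y.2)) ((0 : RP p), y.2) t := by
      refine (hasDerivAt_const t y.1).prodMk ?_
      simpa using (hasDerivAt_id t).mul_const y.2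
    have h2 := ((hg.differentiable (by simp)) (y.1, t * y.2)).hasFDerivAt.comp_hasDerivAt t h1
    have e : ((0 : RP p), y.2) = y.2 • eR := by simp [eR]
    rw [e, map_smul] at h2
    exact h2
  have hc : Continuous (fun t : ℝ => y.2 • dR g (y.1, t * y.2)) := by
    have := (hg.continuous_fderiv (by simp)).clm_apply (continuous_const (y := (eR : RP p × ℝ)))
    exact (this.comp (by fun_prop : Continuous fun t : ℝ => (y.1, t * y.2))).const_smul y.2
  have := intervalIntegral.integral_eq_sub_of_hasDerivAt hd (hc.intervalIntegrable 0 1)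
  rw [intervalIntegral.integral_smul] at this
  simpa using this

variable {D : Set (RP p × ℝ)} {g : RP p × ℝ → Cl n}

/-- Hadamard's lemma: near `r = 0` the quotient is `∫₀¹ ∂_r g (x_p, t r) dt`, which is smooth. -/
theorem contDiffOn_divR (hD : IsOpen D) (hg : ContDiffOn ℝ ∞ g D)
    (h0 : ∀ a, (a, (0 : ℝ)) ∈ D → g (a, 0) = 0) : ContDiffOn ℝ ∞ (divR g) D := by
  intro y₀ hy₀
  refine ContDiffAt.contDiffWithinAt ?_
  by_cases hr : y₀.2 = 0
  -- A global smooth `g'` is substituted because the integral formula is proved for functions smooth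
  -- everywhere. Agreement with `g` is needed near `y` and at its projection `(y.1, 0)`, where `g`
  -- vanishes.
  · obtain ⟨g', hg', -, he⟩ := exists_contDiff_hasCompactSupport_eventuallyEq hD (n := ⊤) hg hy₀
    have hJ : ContDiff ℝ ∞ (dR g') :=
      (hg'.fderiv_right (m := ∞) (by simp)).clm_apply contDiff_const
    refine (contDiff_integral_scale hJ).contDiffAt.congr_of_eventuallyEq ?_
    have hproj : Tendsto (fun y : RP p × ℝ => (y.1, (0 : ℝ))) (𝓝 y₀) (𝓝 y₀) := by
      have : ContinuousAt (fun y : RP p × ℝ => (y.1, (0 : ℝ))) y₀ := by fun_prop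
      rwa [ContinuousAt, show (y₀.1, (0 : ℝ)) = y₀ from Prod.ext rfl hr.symm] at this
    filter_upwards [he.eventuallyEq_nhds, hproj.eventually he,
      hproj.eventually (hD.mem_nhds hy₀)] with y h1 h2 h3
    have key := snd_smul_integral_scale hg' y
    rw [h2, h0 _ h3, sub_zero, h1.self_of_nhds] at key
    by_cases hy : y.2 = 0
    · have : ∀ t : ℝ, (y.1, t * y.2) = y := fun t => Prod.ext rfl (by simp [hy])
      simp only [divR, if_pos hy, this, intervalIntegral.integral_const, sub_zero, one_smul]
      rw [dR_eq, dR_eq, h1.fderiv_eq]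
    · rw [divR, if_neg hy, ← key, inv_smul_smul₀ hy]
  · have hs : ContDiffAt ℝ ∞ (fun y : RP p × ℝ => y.2⁻¹ • g y) y₀ :=
      (contDiffAt_snd.inv hr).smul (hg.contDiffAt (hD.mem_nhds hy₀))
    refine hs.congr_of_eventuallyEq ?_
    filter_upwards [continuousAt_snd.eventually_ne hr] with y hy
    rw [divR, if_neg hy]

theorem snd_smul_divR (h0 : ∀ a, (a, (0 : ℝ)) ∈ D → g (a, 0) = 0) {y : RP p × ℝ} (hy : y ∈ D) :
    y.2 • divR g y = g y := by
  by_cases hr : y.2 = 0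
  · have e : y = (y.1, 0) := Prod.ext rfl hr
    rw [hr, zero_smul, e, h0 _ (e ▸ hy)]
  · rw [divR, if_neg hr, smul_inv_smul₀ hr]

end Division

/-! ### Smooth functions that are even in `r` -/

/-- `u` is smooth on `D` and even in the last variable. -/
structure EvenSmooth {p n : ℕ} (D : Set (RP p × ℝ)) (u : RP p × ℝ → Cl n) : Prop where
  smooth : ContDiffOn ℝ ∞ u D
  even : ∀ a r, (a, r) ∈ D → u (a, -r) = u (a, r)

/-- The operator `r⁻¹ ∂_r`. -/
def radD {p n : ℕ} (u : RP p × ℝ → Cl n) : RP p × ℝ → Cl n := divR (dR u)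

/-- The Laplacian in `x_p`. -/
def lapX {p n : ℕ} (u : RP p × ℝ → Cl n) (y : RP p × ℝ) : Cl n := ∑ i, dX i (dX i u) y

/-- The operator `Δ_{x_p} + ∂_r² + (k - 1) r⁻¹ ∂_r` on even functions, written with
`T = r⁻¹ ∂_r` as `Δ_{x_p} + k T + r² T²`. -/
def axialLap {p n : ℕ} (k : ℝ) (u : RP p × ℝ → Cl n) (y : RP p × ℝ) : Cl n :=
  lapX u y + k • radD u y + y.2 ^ 2 • radD (radD u) y

section Reflection

variable {p n : ℕ} {D : Set (RP p × ℝ)}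

theorem fderiv_reflect (hD : IsOpen D) {u : RP p × ℝ → Cl n} {s : ℝ}
    (h : ∀ a r, (a, r) ∈ D → u (a, -r) = s • u (a, r)) (hu : ContDiffOn ℝ ∞ u D)
    (hDr : ReflInvariant D) {a : RP p} {r : ℝ} (hy : (a, r) ∈ D) (b : RP p) (t : ℝ) :
    fderiv ℝ u (a, -r) (b, -t) = s • fderiv ℝ u (a, r) (b, t) := by
  let σ : RP p × ℝ →L[ℝ] RP p × ℝ :=
    (ContinuousLinearMap.fst ℝ (RP p) ℝ).prod (-ContinuousLinearMap.snd ℝ (RP p) ℝ)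
  have h1 : HasFDerivAt (fun z => u (σ z)) ((fderiv ℝ u (a, -r)).comp σ) (a, r) :=
    (differentiableAt_of_smooth hD hu (hDr a r hy)).hasFDerivAt.comp (a, r) σ.hasFDerivAt
  have h2 : HasFDerivAt (fun z => s • u z) (s • fderiv ℝ u (a, r)) (a, r) :=
    (differentiableAt_of_smooth hD hu hy).hasFDerivAt.const_smul s
  have h3 : (fun z => u (σ z)) =ᶠ[𝓝 (a, r)] fun z => s • u z := by
    filter_upwards [hD.mem_nhds hy] with z hz
    exact h z.1 z.2 hz
  have := (h1.congr_of_eventuallyEq h3.symm).unique h2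
  exact DFunLike.congr_fun this (b, t)

end Reflection

namespace EvenSmooth

variable {p n : ℕ} {D : Set (RP p × ℝ)} {u v : RP p × ℝ → Cl n} {y : RP p × ℝ}

theorem continuousOn (hu : EvenSmooth D u) : ContinuousOn u D := hu.smooth.continuousOn

theorem differentiableAt (hD : IsOpen D) (hu : EvenSmooth D u) (hy : y ∈ D) :
    DifferentiableAt ℝ u y := differentiableAt_of_smooth hD hu.smooth hy

theorem add (hu : EvenSmooth D u) (hv : EvenSmooth D v) : EvenSmooth D fun y => u y + v y :=
  ⟨hu.smooth.add hv.smooth, fun a r h => by rw [hu.even a r h, hv.even a r h]⟩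

theorem sum {ι : Type*} [Fintype ι] {w : ι → RP p × ℝ → Cl n} (h : ∀ i, EvenSmooth D (w i)) :
    EvenSmooth D fun y => ∑ i, w i y :=
  ⟨ContDiffOn.sum fun i _ => (h i).smooth, fun a r hy =>
    Finset.sum_congr rfl fun i _ => (h i).even a r hy⟩

theorem mul_left (c : Cl n) (hu : EvenSmooth D u) : EvenSmooth D fun y => c * u y :=
  ⟨contDiffOn_mul_left c hu.smooth, fun a r h => by rw [hu.even a r h]⟩

theorem const_smul (c : ℝ) (hu : EvenSmooth D u) : EvenSmooth D fun y => c • u y :=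
  ⟨hu.smooth.const_smul c, fun a r h => by rw [hu.even a r h]⟩

theorem sq_smul (hu : EvenSmooth D u) : EvenSmooth D fun y => y.2 ^ 2 • u y :=
  ⟨(contDiff_snd.pow 2).contDiffOn.smul hu.smooth, fun a r h => by simp [hu.even a r h]⟩

theorem conjMul {q : ℕ} {u : RP p × ℝ → Cl (p + q)} (hu : EvenSmooth D u) :
    EvenSmooth D fun y => star (embP q y.1) * u y :=
  ⟨contDiffOn_conjMul hu.smooth, fun a r h => by simp [hu.even a r h]⟩

theorem dX (hD : IsOpen D) (hDr : ReflInvariant D) (hu : EvenSmooth D u) (i : Fin (p + 1)) :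
    EvenSmooth D (dX i u) := by
  refine ⟨contDiffOn_fderiv_apply hD hu.smooth _, fun a r h => ?_⟩
  have := fderiv_reflect hD (s := 1) (by simpa using hu.even) hu.smooth hDr h
    (EuclideanSpace.single i 1) 0
  simpa [PartialSlice.dX] using this

theorem dR_neg (hD : IsOpen D) (hDr : ReflInvariant D) (hu : EvenSmooth D u) {a : RP p} {r : ℝ}
    (h : (a, r) ∈ D) : dR u (a, -r) = -dR u (a, r) := by
  have := fderiv_reflect hD (s := 1) (by simpa using hu.even) hu.smooth hDr h 0 1
  rw [show ((0 : RP p), (-1 : ℝ)) = -(0, 1) by simp, map_neg, one_smul] at this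
  rw [dR, dR, ← this, neg_neg]

end EvenSmooth

section Odd

variable {p n : ℕ} {D : Set (RP p × ℝ)} {g : RP p × ℝ → Cl n}

theorem eq_zero_of_odd (h : ∀ a r, (a, r) ∈ D → g (a, -r) = -g (a, r)) (a : RP p)
    (ha : (a, (0 : ℝ)) ∈ D) : g (a, 0) = 0 := by
  have := h a 0 ha
  rw [neg_zero] at this
  have h2 : (2 : ℝ) • g (a, 0) = 0 := by
    rw [two_smul]
    nth_rewrite 1 [this]
    exact neg_add_cancel _
  exact (smul_eq_zero.1 h2).resolve_left two_ne_zero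

theorem evenSmooth_divR (hD : IsOpen D) (hg : ContDiffOn ℝ ∞ g D)
    (h : ∀ a r, (a, r) ∈ D → g (a, -r) = -g (a, r)) : EvenSmooth D (divR g) := by
  refine ⟨contDiffOn_divR hD hg (eq_zero_of_odd h), fun a r hy => ?_⟩
  by_cases hr : r = 0
  · rw [hr, neg_zero]
  · have h1 : divR g (a, r) = r⁻¹ • g (a, r) := if_neg hr
    have h2 : divR g (a, -r) = (-r)⁻¹ • g (a, -r) := if_neg (neg_ne_zero.2 hr)
    rw [h1, h2, h a r hy, inv_neg, neg_smul_neg]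

end Odd

namespace EvenSmooth

variable {p n : ℕ} {D : Set (RP p × ℝ)} {u v : RP p × ℝ → Cl n} {y : RP p × ℝ}

theorem radD (hD : IsOpen D) (hDr : ReflInvariant D) (hu : EvenSmooth D u) :
    EvenSmooth D (radD u) :=
  evenSmooth_divR hD (contDiffOn_fderiv_apply hD hu.smooth _) fun _ _ h => hu.dR_neg hD hDr h

theorem snd_smul_radD (hD : IsOpen D) (hDr : ReflInvariant D) (hu : EvenSmooth D u) (hy : y ∈ D) :
    y.2 • PartialSlice.radD u y = dR u y :=
  snd_smul_divR (eq_zero_of_odd fun _ _ h => hu.dR_neg hD hDr h) hy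

/-- `r⁻¹ ∂_r u` is characterized by `r w = ∂_r u`. -/
theorem radD_eqOn (hD : IsOpen D) (hDr : ReflInvariant D) (hu : EvenSmooth D u)
    (hv : EvenSmooth D v) (h : ∀ y ∈ D, dR u y = y.2 • v y) :
    Set.EqOn (PartialSlice.radD u) v D :=
  eqOn_of_snd_smul_eqOn hD (hu.radD hD hDr).continuousOn hv.continuousOn fun y hy => by
    rw [hu.snd_smul_radD hD hDr hy, h y hy]

theorem lapX (hD : IsOpen D) (hDr : ReflInvariant D) (hu : EvenSmooth D u) :
    EvenSmooth D (lapX u) :=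
  EvenSmooth.sum fun i => (hu.dX hD hDr i).dX hD hDr i

theorem radD_iterate (hD : IsOpen D) (hDr : ReflInvariant D) (hu : EvenSmooth D u) (j : ℕ) :
    EvenSmooth D (PartialSlice.radD^[j] u) := by
  induction j with
  | zero => exact hu
  | succ j ih => rw [Function.iterate_succ_apply']; exact ih.radD hD hDr

end EvenSmooth

/-! ### Commutation rules for `T = r⁻¹ ∂_r` -/

section Rules

variable {p n : ℕ} {D : Set (RP p × ℝ)} {u v : RP p × ℝ → Cl n}

theorem radD_congr (hD : IsOpen D) (h : Set.EqOn u v D) :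
    Set.EqOn (radD u) (radD v) D := by
  intro y hy
  by_cases hr : y.2 = 0
  · simp only [radD, divR, if_pos hr]
    exact dR_congr hD (dR_congr hD h) hy
  · simp only [radD, divR, if_neg hr]
    rw [dR_congr hD h hy]

theorem radD_mul_left (hD : IsOpen D) (hDr : ReflInvariant D) (hu : EvenSmooth D u)
    (c : Cl n) : Set.EqOn (radD fun y => c * u y) (fun y => c * radD u y) D :=
  (hu.mul_left c).radD_eqOn hD hDr ((hu.radD hD hDr).mul_left c) fun y hy => by
    rw [dR_eq, fderiv_mul_left_apply (hu.differentiableAt hD hy), ← dR_eq,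
      ← hu.snd_smul_radD hD hDr hy, mul_smul_comm]

theorem radD_const_smul (hD : IsOpen D) (hDr : ReflInvariant D) (hu : EvenSmooth D u)
    (c : ℝ) :
    Set.EqOn (radD fun y => c • u y) (fun y => c • radD u y) D := by
  have := radD_mul_left hD hDr hu (c • (1 : Cl n))
  simpa only [smul_mul_assoc, one_mul] using this

theorem radD_conjMul (hD : IsOpen D) (hDr : ReflInvariant D) {q : ℕ}
    {u : RP p × ℝ → Cl (p + q)} (hu : EvenSmooth D u) :
    Set.EqOn (radD fun y => star (embP q y.1) * u y) (fun y => star (embP q y.1) * radD u y) D :=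
  hu.conjMul.radD_eqOn hD hDr (hu.radD hD hDr).conjMul fun y hy => by
    rw [dR_conjMul (hu.differentiableAt hD hy), ← hu.snd_smul_radD hD hDr hy, mul_smul_comm]

/-- The commutator `T r² - r² T = 2` is the source of the shift `k ↦ k + 2` in `radD_axialLap` and
of the constant `3` in `axialLap_of_cauchyRiemann`. -/
theorem radD_sq_smul (hD : IsOpen D) (hDr : ReflInvariant D) (hu : EvenSmooth D u) :
     Set.EqOn (radD fun y => y.2 ^ 2 • u y)
    (fun y => (2 : ℝ) • u y + y.2 ^ 2 • radD u y) D :=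
  hu.sq_smul.radD_eqOn hD hDr ((hu.const_smul 2).add (hu.radD hD hDr).sq_smul) fun y hy => by
    have h2 : fderiv ℝ (fun z : RP p × ℝ => z.2 ^ 2) y eR = 2 * y.2 := by
      rw [fderiv_fun_pow 2 differentiableAt_snd, smul_apply, fderiv_snd_eR]
      simp
    rw [dR_eq, fderiv_smul_apply (differentiableAt_snd.fun_pow 2) (hu.differentiableAt hD hy), h2,
      ← dR_eq, ← hu.snd_smul_radD hD hDr hy]
    module

/-- After multiplication by `r` this is `∂_r ∂_{xᵢ} u = ∂_{xᵢ} ∂_r u`, since `∂_{xᵢ}` commutes with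
`r`. -/
theorem radD_dX (hD : IsOpen D) (hDr : ReflInvariant D) (hu : EvenSmooth D u)
    (i : Fin (p + 1)) : Set.EqOn (radD (dX i u)) (dX i (radD u)) D :=
  (hu.dX hD hDr i).radD_eqOn hD hDr ((hu.radD hD hDr).dX hD hDr i) fun y hy => by
    rw [← dX_snd_smul ((hu.radD hD hDr).differentiableAt hD hy),
      dX_congr hD (fun z hz => hu.snd_smul_radD hD hDr hz) i hy]
    exact fderiv_comm_of_smooth hD hu.smooth hy (eX i) eR

theorem radD_sum (hD : IsOpen D) (hDr : ReflInvariant D) {ι : Type*} [Fintype ι] {w : ι → RP p × ℝ → Cl n}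
    (h : ∀ i, EvenSmooth D (w i)) :
    Set.EqOn (radD fun y => ∑ i, w i y) (fun y => ∑ i, radD (w i) y) D :=
  (EvenSmooth.sum h).radD_eqOn hD hDr (EvenSmooth.sum fun i => (h i).radD hD hDr) fun y hy => by
    rw [dR_eq, fderiv_fun_sum fun i _ => (h i).differentiableAt hD hy, FunLike.coe_sum,
      Finset.sum_apply, Finset.smul_sum]
    exact Finset.sum_congr rfl fun i _ => ((h i).snd_smul_radD hD hDr hy).symm

theorem radD_add (hD : IsOpen D) (hDr : ReflInvariant D) (hu : EvenSmooth D u)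
    (hv : EvenSmooth D v) :
    Set.EqOn (radD fun y => u y + v y) (fun y => radD u y + radD v y) D :=
  (hu.add hv).radD_eqOn hD hDr ((hu.radD hD hDr).add (hv.radD hD hDr)) fun y hy => by
    rw [dR_eq, fderiv_add_apply' (hu.differentiableAt hD hy) (hv.differentiableAt hD hy),
      ← dR_eq, ← dR_eq, ← hu.snd_smul_radD hD hDr hy, ← hv.snd_smul_radD hD hDr hy, smul_add]

/-- `T` commutes with `Δ_{x_p}`, while `T (r² T² u) = 2 T² u + r² T³ u` contributes the extra `2`.
-/
theorem radD_axialLap (hD : IsOpen D) (hDr : ReflInvariant D) (hu : EvenSmooth D u)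
    (k : ℝ) :
    Set.EqOn (radD (axialLap k u)) (axialLap (k + 2) (radD u)) D := by
  intro y hy
  have hT := hu.radD hD hDr
  have hTT := hT.radD hD hDr
  have h1 : radD (axialLap k u) y
      = radD (lapX u) y + k • radD (radD u) y
        + ((2 : ℝ) • radD (radD u) y + y.2 ^ 2 • radD (radD (radD u)) y) := by
    have e := radD_add hD hDr ((hu.lapX hD hDr).add (hT.const_smul k)) hTT.sq_smul hy
    simp only [radD_sq_smul hD hDr hTT hy, radD_add hD hDr (hu.lapX hD hDr) (hT.const_smul k) hy,
      radD_const_smul hD hDr hT k hy] at e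
    exact e
  have h2 : radD (lapX u) y = lapX (radD u) y := by
    refine (radD_sum hD hDr (w := fun i => dX i (dX i u))
      fun i => (hu.dX hD hDr i).dX hD hDr i) hy |>.trans ?_
    refine Finset.sum_congr rfl fun i _ => ?_
    rw [radD_dX hD hDr (hu.dX hD hDr i) i hy]
    exact dX_congr hD (radD_dX hD hDr hu i) i hy
  rw [h1, h2, axialLap]
  module

theorem axialLap_radD_iterate (hD : IsOpen D) (hDr : ReflInvariant D) (hu : EvenSmooth D u)
    (h : ∀ y ∈ D, axialLap 3 u y = 0) (j : ℕ) :
    ∀ y ∈ D, axialLap (3 + 2 * j) (radD^[j] u) y = 0 := by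
  induction j with
  | zero => simpa using h
  | succ j ih =>
    intro y hy
    have hz : EvenSmooth D (fun _ : RP p × ℝ => (0 : Cl n)) := ⟨contDiffOn_const, fun _ _ _ => rfl⟩
    have h1 := radD_axialLap hD hDr (hu.radD_iterate hD hDr j) (3 + 2 * j) hy
    rw [radD_congr hD (v := fun _ => 0) (fun z hz => ih z hz) hy,
      hz.radD_eqOn hD hDr hz (fun z _ => by simp [dR]) hy] at h1
    have h1' : (0 : Cl n) = _ := h1
    rw [Function.iterate_succ_apply']
    push_cast
    rw [mul_add, mul_one, ← add_assoc, ← h1']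

end Rules

/-! ### Consequences of the generalized Cauchy-Riemann equations -/

section CauchyRiemann

variable {p q : ℕ} {D : Set (RP p × ℝ)} {F₁ w : RP p × ℝ → Cl (p + q)}

theorem evenSmooth_diracBar (hD : IsOpen D) (hDr : ReflInvariant D) {u : RP p × ℝ → Cl (p + q)}
    (hu : EvenSmooth D u) : EvenSmooth D (diracBar u) :=
  EvenSmooth.sum fun i => (hu.dX hD hDr i).mul_left _

theorem radD_dirac (hD : IsOpen D) (hDr : ReflInvariant D) {u : RP p × ℝ → Cl (p + q)}
    (hu : EvenSmooth D u) : Set.EqOn (radD (dirac u)) (dirac (radD u)) D := fun y hy => by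
  refine (radD_sum hD hDr (w := fun i y => unitP p q i * dX i u y)
    (fun i => (hu.dX hD hDr i).mul_left _) hy).trans ?_
  refine Finset.sum_congr rfl fun i _ => ?_
  rw [radD_mul_left hD hDr (hu.dX hD hDr i) _ hy]
  simp only [radD_dX hD hDr hu i hy]

theorem radD_diracBar (hD : IsOpen D) (hDr : ReflInvariant D) {u : RP p × ℝ → Cl (p + q)}
    (hu : EvenSmooth D u) : Set.EqOn (radD (diracBar u)) (diracBar (radD u)) D := fun y hy => by
  refine (radD_sum hD hDr (w := fun i y => star (unitP p q i) * dX i u y)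
    (fun i => (hu.dX hD hDr i).mul_left _) hy).trans ?_
  refine Finset.sum_congr rfl fun i _ => ?_
  rw [radD_mul_left hD hDr (hu.dX hD hDr i) _ hy]
  simp only [radD_dX hD hDr hu i hy]

theorem dX_sum_mul (hD : IsOpen D) (hDr : ReflInvariant D) {u : RP p × ℝ → Cl (p + q)}
    (hu : EvenSmooth D u) (c : Fin (p + 1) → Cl (p + q)) (i : Fin (p + 1)) {y : RP p × ℝ}
    (hy : y ∈ D) : dX i (fun z => ∑ j, c j * dX j u z) y = ∑ j, c j * dX i (dX j u) y := by
  rw [dX_eq, fderiv_fun_sum fun j _ => ((hu.dX hD hDr j).mul_left (c j)).differentiableAt hD hy,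
    FunLike.coe_sum, Finset.sum_apply]
  exact Finset.sum_congr rfl fun j _ =>
    fderiv_mul_left_apply ((hu.dX hD hDr j).differentiableAt hD hy) _ _

theorem dX_dX_comm (hD : IsOpen D) {u : RP p × ℝ → Cl (p + q)} (hu : EvenSmooth D u)
    (i j : Fin (p + 1)) {y : RP p × ℝ} (hy : y ∈ D) : dX i (dX j u) y = dX j (dX i u) y :=
  fderiv_comm_of_smooth hD hu.smooth hy (eX j) (eX i)

theorem dirac_diracBar (hD : IsOpen D) (hDr : ReflInvariant D) {u : RP p × ℝ → Cl (p + q)}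
    (hu : EvenSmooth D u) : Set.EqOn (dirac (diracBar u)) (lapX u) D := fun y hy => by
  rw [lapX, ← sum_unitP_mul_star_unitP p q (X := fun i j => dX i (dX j u) y)
    fun i j => dX_dX_comm hD hu i j hy]
  exact Finset.sum_congr rfl fun i _ =>
    congrArg _ (dX_sum_mul hD hDr hu (fun j => star (unitP p q j)) i hy)

theorem diracBar_dirac (hD : IsOpen D) (hDr : ReflInvariant D) {u : RP p × ℝ → Cl (p + q)}
    (hu : EvenSmooth D u) : Set.EqOn (diracBar (dirac u)) (lapX u) D := fun y hy => by
  rw [lapX, ← sum_star_unitP_mul_unitP p q (X := fun i j => dX i (dX j u) y)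
    fun i j => dX_dX_comm hD hu i j hy]
  exact Finset.sum_congr rfl fun i _ => congrArg _ (dX_sum_mul hD hDr hu (unitP p q) i hy)

theorem dirac_congr (hD : IsOpen D) {u v : RP p × ℝ → Cl (p + q)} (h : Set.EqOn u v D) :
    Set.EqOn (dirac u) (dirac v) D := fun y hy => by
  simp only [dirac, dX_congr hD h _ hy]

theorem diracBar_congr (hD : IsOpen D) {u v : RP p × ℝ → Cl (p + q)} (h : Set.EqOn u v D) :
    Set.EqOn (diracBar u) (diracBar v) D := fun y hy => by
  simp only [diracBar, dX_congr hD h _ hy]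

theorem dirac_neg (u : RP p × ℝ → Cl (p + q)) (y : RP p × ℝ) :
    dirac (fun z => -u z) y = -dirac u y := by
  have h : ∀ i, dX i (fun z => -u z) y = -dX i u y := fun i => by
    rw [dX_eq, fderiv_fun_neg]; rfl
  simp only [dirac, h, mul_neg, Finset.sum_neg_distrib]

theorem diracBar_snd_smul {u : RP p × ℝ → Cl (p + q)} {y : RP p × ℝ}
    (hu : DifferentiableAt ℝ u y) : diracBar (fun z => z.2 • u z) y = y.2 • diracBar u y := by
  simp only [diracBar, dX_snd_smul hu, mul_smul_comm, Finset.smul_sum]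

theorem diracBar_add_sq_smul {u v : RP p × ℝ → Cl (p + q)} {y : RP p × ℝ}
    (hu : DifferentiableAt ℝ u y) (hv : DifferentiableAt ℝ v y) :
    diracBar (fun z => u z + z.2 ^ 2 • v z) y = diracBar u y + y.2 ^ 2 • diracBar v y := by
  have h2 : ∀ i, fderiv ℝ (fun z : RP p × ℝ => z.2 ^ 2) y (eX i) = 0 := fun i => by
    rw [fderiv_fun_pow 2 differentiableAt_snd, smul_apply, fderiv_snd_eX, smul_zero]
  have h : ∀ i, dX i (fun z => u z + z.2 ^ 2 • v z) y = dX i u y + y.2 ^ 2 • dX i v y := fun i => by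
    rw [dX_eq, fderiv_add_apply' hu ((differentiableAt_snd.fun_pow 2).fun_smul hv),
      fderiv_smul_apply (differentiableAt_snd.fun_pow 2) hv, h2, zero_smul, add_zero]
    rfl
  simp only [diracBar, h, mul_add, mul_smul_comm, Finset.sum_add_distrib, Finset.smul_sum]

/-- The hypotheses are the generalized Cauchy-Riemann equations for the pair `(F₁, r w)`. -/
theorem axialLap_of_cauchyRiemann (hD : IsOpen D) (hDr : ReflInvariant D) (hF : EvenSmooth D F₁)
    (hw : EvenSmooth D w)
    (h1 : ∀ y ∈ D, dirac F₁ y = dR (fun z => z.2 • w z) y)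
    (h2 : ∀ y ∈ D, diracBar (fun z => z.2 • w z) y = -dR F₁ y) :
    (∀ y ∈ D, axialLap 3 w y = 0) ∧
      ∀ y ∈ D, axialLap 3 (fun z => F₁ z + star (embP q z.1) * w z) y = 0 := by
  have hTw := hw.radD hD hDr
  have hTF := hF.radD hD hDr
  -- In terms of `T` the system reads `D F₁ = w + r² T w` and `D̄ w = -T F₁`; the second equation is
  -- divided by `r`, with continuity covering `r = 0`.
  have e1 : Set.EqOn (dirac F₁) (fun y => w y + y.2 ^ 2 • radD w y) D := fun y hy => by
    rw [h1 y hy, dR_snd_smul (hw.differentiableAt hD hy), ← hw.snd_smul_radD hD hDr hy, smul_smul,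
      ← pow_two]
  have e2 : Set.EqOn (diracBar w) (fun y => -radD F₁ y) D := by
    refine eqOn_of_snd_smul_eqOn hD (evenSmooth_diracBar hD hDr hw).continuousOn
      hTF.continuousOn.neg fun y hy => ?_
    rw [← diracBar_snd_smul (hw.differentiableAt hD hy), h2 y hy, ← hF.snd_smul_radD hD hDr hy,
      smul_neg]
  -- `Δ_{x_p} w = D D̄ w = -T D F₁ = -T (w + r² T w)`, and the commutator with `r²` turns `1` into
  -- `3`.
  have hlw : ∀ y ∈ D, lapX w y = -((3 : ℝ) • radD w y + y.2 ^ 2 • radD (radD w) y) := by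
    intro y hy
    rw [← dirac_diracBar hD hDr hw hy, dirac_congr hD e2 hy, dirac_neg,
      ← radD_dirac hD hDr hF hy, radD_congr hD e1 hy, radD_add hD hDr hw hTw.sq_smul hy]
    simp only
    rw [radD_sq_smul hD hDr hTw hy]
    module
  -- `Δ_{x_p} F₁ = D̄ D F₁ = D̄ w + r² T D̄ w`, so `F₁` solves the equation with `k = 1` rather than
  -- `3`.
  have hlF : ∀ y ∈ D, lapX F₁ y = -(radD F₁ y + y.2 ^ 2 • radD (radD F₁) y) := by
    intro y hy
    have hneg : radD (fun z => -radD F₁ z) y = -radD (radD F₁) y := by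
      simpa using radD_const_smul hD hDr hTF (-1) hy
    rw [← diracBar_dirac hD hDr hF hy, diracBar_congr hD e1 hy,
      diracBar_add_sq_smul (hw.differentiableAt hD hy) (hTw.differentiableAt hD hy),
      ← radD_diracBar hD hDr hw hy, radD_congr hD e2 hy, e2 hy, hneg]
    module
  have hw3 : ∀ y ∈ D, axialLap 3 w y = 0 := by
    intro y hy
    rw [axialLap, hlw y hy]
    module
  refine ⟨hw3, fun y hy => ?_⟩
  have hcw := hw.conjMul
  have hT1 : Set.EqOn (radD fun z => F₁ z + star (embP q z.1) * w z)
      (fun z => radD F₁ z + star (embP q z.1) * radD w z) D := fun z hz => by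
    rw [radD_add hD hDr hF hcw hz]
    simp only
    rw [radD_conjMul hD hDr hw hz]
  have hT2 : radD (radD fun z => F₁ z + star (embP q z.1) * w z) y
      = radD (radD F₁) y + star (embP q y.1) * radD (radD w) y := by
    rw [radD_congr hD hT1 hy, radD_add hD hDr hTF hTw.conjMul hy]
    simp only
    rw [radD_conjMul hD hDr hTw hy]
  have hX1 : ∀ i, Set.EqOn (dX i fun z => F₁ z + star (embP q z.1) * w z)
      (fun z => dX i F₁ z + (star (unitP p q i) * w z + star (embP q z.1) * dX i w z)) D := by
    intro i z hz
    rw [dX_eq, fderiv_add_apply' (hF.differentiableAt hD hz) (hcw.differentiableAt hD hz), ← dX_eq,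
      ← dX_eq, dX_conjMul (hw.differentiableAt hD hz)]
  have hX2 : ∀ i, dX i (dX i fun z => F₁ z + star (embP q z.1) * w z) y
      = dX i (dX i F₁) y + ((2 : ℝ) • (star (unitP p q i) * dX i w y)
        + star (embP q y.1) * dX i (dX i w) y) := by
    intro i
    have hXw := hw.dX hD hDr i
    have hXF := hF.dX hD hDr i
    rw [dX_congr hD (hX1 i) i hy, dX_eq, fderiv_add_apply' (hXF.differentiableAt hD hy)
        (((hw.mul_left _).add hXw.conjMul).differentiableAt hD hy),
      fderiv_add_apply' ((hw.mul_left _).differentiableAt hD hy)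
        (hXw.conjMul.differentiableAt hD hy), fderiv_mul_left_apply (hw.differentiableAt hD hy),
      ← dX_eq, ← dX_eq, ← dX_eq, dX_conjMul (hXw.differentiableAt hD hy)]
    module
  have hlap : lapX (fun z => F₁ z + star (embP q z.1) * w z) y
      = lapX F₁ y + ((2 : ℝ) • diracBar w y + star (embP q y.1) * lapX w y) := by
    simp only [lapX, hX2, Finset.sum_add_distrib, diracBar, Finset.smul_sum, Finset.mul_sum]
  have hwz : star (embP q y.1) * lapX w y
      = -((3 : ℝ) • (star (embP q y.1) * radD w y)
        + y.2 ^ 2 • (star (embP q y.1) * radD (radD w) y)) := by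
    rw [hlw y hy, mul_neg, mul_add, mul_smul_comm, mul_smul_comm]
  -- The cross term `2 D̄ w = -2 T F₁` of `Δ_{x_p} (x̄_p w)` compensates exactly for the missing `2
  -- T F₁` in the equation of `F₁`; this is why `x̄_p w` is added.
  rw [axialLap, hlap, hwz, hT1 hy, hT2, hlF y hy, e2 hy]
  module

end CauchyRiemann

/-! ### Functions of `(x_p, |x_q|)` -/

instance instContinuousSMulRPQ (p q : ℕ) : ContinuousSMul ℝ (RPQ p q) :=
  IsBoundedSMul.continuousSMul

section Radial

variable {p q : ℕ} {D : Set (RP p × ℝ)}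

/-- The coordinates `(x_p, |x_q|)` of `x`. -/
def polar (x : RPQ p q) : RP p × ℝ := (x.fst, ‖x.snd‖)

theorem continuous_polar : Continuous (polar : RPQ p q → RP p × ℝ) := by
  unfold polar
  fun_prop

theorem exists_mem_sph (hq : 0 < q) (b : RQ q) : ∃ w₀ ∈ sph q, b = ‖b‖ • w₀ := by
  by_cases hb : b = 0
  · exact ⟨EuclideanSpace.single ⟨0, hq⟩ 1, by simp [sph], by simp [hb]⟩
  · have hn : ‖b‖ ≠ 0 := norm_ne_zero_iff.2 hb
    exact ⟨‖b‖⁻¹ • b, by simp [sph, norm_smul, hn], (smul_inv_smul₀ hn b).symm⟩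

theorem norm_smul_of_mem_sph {w₀ : RQ q} (hw : w₀ ∈ sph q) (r : ℝ) : ‖r • w₀‖ = |r| := by
  have : ‖w₀‖ = 1 := by simpa [sph] using hw
  rw [norm_smul, this, mul_one, Real.norm_eq_abs]

theorem mem_completion_iff (hq : 0 < q) {x : RPQ p q} : x ∈ completion q D ↔ polar x ∈ D := by
  constructor
  · rintro ⟨w₀, hw, a, r, hr, hD, rfl⟩
    have : polar (pt a (r • w₀)) = (a, r) := by
      simp [polar, pt, norm_smul_of_mem_sph hw, abs_of_nonneg hr]
    rwa [this]
  · intro hx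
    obtain ⟨w₀, hw, he⟩ := exists_mem_sph hq x.snd
    exact ⟨w₀, hw, x.fst, ‖x.snd‖, norm_nonneg _, hx, by rw [← he]; rfl⟩

theorem isOpen_completion (hq : 0 < q) (hD : IsOpen D) : IsOpen (completion q D) := by
  have : completion q D = polar ⁻¹' D := Set.ext fun x => mem_completion_iff hq
  rw [this]
  exact hD.preimage continuous_polar

/-- The function `x ↦ u (x_p, |x_q|)` on `ℝ^{p+q+1}`. -/
def radial {n : ℕ} (u : RP p × ℝ → Cl n) (x : RPQ p q) : Cl n := u (polar x)

/-- The derivative of `radial u` at `x`. -/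
def radialDeriv {n : ℕ} (u : RP p × ℝ → Cl n) (x : RPQ p q) : RPQ p q →L[ℝ] Cl n :=
  (fderiv ℝ u (polar x)).comp
      ((ContinuousLinearMap.inl ℝ (RP p) ℝ).comp (WithLp.fstL 2 ℝ (RP p) (RQ q)))
    + ((innerSL ℝ x.snd).comp (WithLp.sndL 2 ℝ (RP p) (RQ q))).smulRight (radD u (polar x))

theorem radialDeriv_apply {n : ℕ} (u : RP p × ℝ → Cl n) (x e : RPQ p q) :
    radialDeriv u x e
      = fderiv ℝ u (polar x) (e.fst, 0) + inner ℝ x.snd e.snd • radD u (polar x) := rfl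

theorem radialDeriv_apply_eq_sum {n : ℕ} (u : RP p × ℝ → Cl n) (x e : RPQ p q) :
    radialDeriv u x e
      = ∑ i, e.fst i • radial (dX i u) x + inner ℝ x.snd e.snd • radial (radD u) x := by
  rw [radialDeriv_apply, map_eq_sum_coord]
  simp [radial, dX_eq]

variable {n : ℕ} {u : RP p × ℝ → Cl n}

/-- Where `x_q ≠ 0` this is the chain rule, with `∂_r u = r T u` absorbing the factor `|x_q|⁻¹` of
the derivative of the norm. Where `x_q = 0` the norm is not differentiable, but `∂_r u` vanishes
there. -/
theorem hasFDerivAt_radial (hD : IsOpen D) (hDr : ReflInvariant D) (hu : EvenSmooth D u)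
    {x : RPQ p q} (hx : polar x ∈ D) : HasFDerivAt (radial u) (radialDeriv u x) x := by
  have hd := (hu.differentiableAt hD hx).hasFDerivAt
  have hfst : HasFDerivAt (fun z : RPQ p q => z.fst) (WithLp.fstL 2 ℝ (RP p) (RQ q)) x :=
    (WithLp.fstL 2 ℝ (RP p) (RQ q)).hasFDerivAt
  have hsnd : HasFDerivAt (fun z : RPQ p q => z.snd) (WithLp.sndL 2 ℝ (RP p) (RQ q)) x :=
    (WithLp.sndL 2 ℝ (RP p) (RQ q)).hasFDerivAt
  have hsplit : ∀ (a : RP p) (s : ℝ), fderiv ℝ u (polar x) (a, s)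
      = fderiv ℝ u (polar x) (a, 0) + s • (‖x.snd‖ • radD u (polar x)) := by
    intro a s
    have h1 : ‖x.snd‖ • radD u (polar x) = dR u (polar x) := hu.snd_smul_radD hD hDr hx
    rw [h1, dR_eq, ← map_smul, ← map_add]
    simp [eR]
  by_cases h0 : x.snd = 0
  · have hz : ∀ e : RPQ p q, radialDeriv u x e = fderiv ℝ u (polar x) (e.fst, ‖e.snd‖) := by
      intro e
      rw [radialDeriv_apply, hsplit e.fst ‖e.snd‖, h0]
      simp
    have hpx : polar x = (x.fst, 0) := by simp [polar, h0]
    rw [hasFDerivAt_iff_isLittleO] at hd ⊢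
    have hcomp := hd.comp_tendsto (continuous_polar.continuousAt (x := x))
    -- Since `polar z - polar x` is at most `z - x` in norm, the first order expansion of `u` at
    -- `polar x` can be composed with `polar`, even though `polar` itself is not differentiable.
    have hO : (fun z : RPQ p q => polar z - polar x) =O[𝓝 x] fun z => z - x := by
      refine Asymptotics.IsBigO.of_bound 1 (Eventually.of_forall fun z => ?_)
      rw [one_mul, Prod.norm_def]
      refine max_le ?_ ?_
      · exact WithLp.norm_fst_le _ (z - x)
      · rw [hpx]
        have := WithLp.norm_snd_le _ (z - x)
        rw [WithLp.sub_snd, h0, sub_zero] at this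
        simpa [polar] using this
    refine (hcomp.trans_isBigO hO).congr_left fun z => ?_
    rw [hz]
    have : polar z - polar x = ((z - x).fst, ‖(z - x).snd‖) := by
      rw [hpx, WithLp.sub_snd, h0, sub_zero]
      simp [polar]
    simp only [Function.comp, this, radial]
  · have hn : ‖x.snd‖ ≠ 0 := norm_ne_zero_iff.2 h0
    have hnorm : HasFDerivAt (fun z : RPQ p q => ‖z.snd‖)
        (‖x.snd‖⁻¹ • (innerSL ℝ x.snd).comp (WithLp.sndL 2 ℝ (RP p) (RQ q))) x := by
      have h1 := hsnd.norm_sq.sqrt (pow_ne_zero 2 hn)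
      simp only [Real.sqrt_sq (norm_nonneg _)] at h1
      refine h1.congr_fderiv ?_
      rw [← Nat.cast_smul_eq_nsmul ℝ, smul_smul]
      congr 1
      field_simp
      simp
    refine (hd.comp x (hfst.prodMk hnorm)).congr_fderiv ?_
    ext e
    have h2 : ((fderiv ℝ u (polar x)).comp ((WithLp.fstL 2 ℝ (RP p) (RQ q)).prod
        (‖x.snd‖⁻¹ • (innerSL ℝ x.snd).comp (WithLp.sndL 2 ℝ (RP p) (RQ q))))) e
        = fderiv ℝ u (polar x) (e.fst, ‖x.snd‖⁻¹ * inner ℝ x.snd e.snd) := rfl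
    have h3 : ‖x.snd‖⁻¹ * inner ℝ x.snd e.snd * ‖x.snd‖ = inner ℝ x.snd e.snd := by
      field_simp
    rw [h2, hsplit, radialDeriv_apply, smul_smul, h3]

theorem fderiv_radial_apply (hD : IsOpen D) (hDr : ReflInvariant D) (hu : EvenSmooth D u)
    {x : RPQ p q} (hx : polar x ∈ D) (e : RPQ p q) : fderiv ℝ (radial u) x e
      = ∑ i, e.fst i • radial (dX i u) x + inner ℝ x.snd e.snd • radial (radD u) x := by
  rw [(hasFDerivAt_radial hD hDr hu hx).fderiv, radialDeriv_apply_eq_sum]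

/-- The induction closes over all even smooth `u` at once: each directional derivative of `radial u`
is a combination, with smooth coefficients, of the radial functions of `∂_{xᵢ} u` and `T u`, which
are again even and smooth. -/
theorem contDiffOn_nat_radial (hq : 0 < q) (hD : IsOpen D) (hDr : ReflInvariant D) (k : ℕ) :
    ∀ u : RP p × ℝ → Cl n, EvenSmooth D u →
      ContDiffOn ℝ k (radial u : RPQ p q → Cl n) (completion q D) := by
  induction k with
  | zero =>
    intro u hu
    refine contDiffOn_zero.2 (hu.continuousOn.comp continuous_polar.continuousOn fun x hx => ?_)
    exact (mem_completion_iff hq).1 hx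
  | succ k ih =>
    intro u hu
    have hsucc : ((k + 1 : ℕ) : ℕ∞ω) = (k : ℕ∞ω) + 1 := by norm_cast
    rw [hsucc, contDiffOn_succ_iff_fderiv_of_isOpen (isOpen_completion hq hD)]
    refine ⟨fun x hx => (hasFDerivAt_radial hD hDr hu
      ((mem_completion_iff hq).1 hx)).differentiableAt.differentiableWithinAt, by simp, ?_⟩
    refine contDiffOn_clm_apply.2 fun e => ?_
    refine ContDiffOn.congr ?_ fun x hx =>
      fderiv_radial_apply hD hDr hu ((mem_completion_iff hq).1 hx) e
    refine ContDiffOn.add (ContDiffOn.sum fun i _ => (ih _ (hu.dX hD hDr i)).const_smul _) ?_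
    refine ContDiffOn.fun_smul ?_ (ih _ (hu.radD hD hDr))
    exact ((WithLp.sndL 2 ℝ (RP p) (RQ q)).contDiff.inner ℝ contDiff_const).contDiffOn

theorem contDiffOn_radial (hq : 0 < q) (hD : IsOpen D) (hDr : ReflInvariant D)
    (hu : EvenSmooth D u) : ContDiffOn ℝ ∞ (radial u : RPQ p q → Cl n) (completion q D) :=
  contDiffOn_infty.2 fun k => contDiffOn_nat_radial hq hD hDr k u hu

theorem iteratedFDeriv_two_eq {E F : Type*} [NormedAddCommGroup E] [NormedSpace ℝ E]
    [NormedAddCommGroup F] [NormedSpace ℝ F] {f : E → F} {x : E} (hf : ContDiffAt ℝ 2 f x) (e : E) :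
    iteratedFDeriv ℝ 2 f x ![e, e] = fderiv ℝ (fun z => fderiv ℝ f z e) x e := by
  have hd : DifferentiableAt ℝ (fderiv ℝ f) x :=
    (hf.fderiv_right (m := 1) (by norm_num)).differentiableAt one_ne_zero
  rw [iteratedFDeriv_two_apply, fderiv_clm_apply hd (differentiableAt_const e)]
  simp

/-- In a coordinate direction of `ℝ^q` the first derivative is `x_j T u` and the second is `T u +
x_j² T² u`; summing over the `q` directions gives `q T u + |x_q|² T² u`. -/
theorem laplacian_radial (hq : 0 < q) (hD : IsOpen D) (hDr : ReflInvariant D)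
    (hu : EvenSmooth D u) {x : RPQ p q} (hx : x ∈ completion q D) :
    Laplacian.laplacian (radial u) x = radial (axialLap q u) x := by
  have hΩ := isOpen_completion (q := q) hq hD
  have hc2 : ContDiffAt ℝ 2 (radial u : RPQ p q → Cl n) x :=
    ((contDiffOn_radial hq hD hDr hu).contDiffAt (hΩ.mem_nhds hx)).of_le
      (WithTop.coe_le_coe.2 le_top)
  have hmem : ∀ {z : RPQ p q}, z ∈ completion q D → polar z ∈ D := (mem_completion_iff hq).1
  let b := (EuclideanSpace.basisFun (Fin (p + 1)) ℝ).prod (EuclideanSpace.basisFun (Fin q) ℝ)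
  rw [congrFun (InnerProductSpace.laplacian_eq_iteratedFDeriv_orthonormalBasis _ b) x,
    Fintype.sum_sum_type]
  simp only [iteratedFDeriv_two_eq hc2]
  have hX : ∀ {w : RP p × ℝ → Cl n}, EvenSmooth D w → ∀ {z : RPQ p q}, z ∈ completion q D →
      ∀ i, fderiv ℝ (radial w) z (b (Sum.inl i)) = radial (dX i w) z := by
    intro w hw z hz i
    rw [fderiv_radial_apply hD hDr hw (hmem hz)]
    simp [b]
  have hQ : ∀ {w : RP p × ℝ → Cl n}, EvenSmooth D w → ∀ {z : RPQ p q}, z ∈ completion q D →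
      ∀ j, fderiv ℝ (radial w) z (b (Sum.inr j)) = z.snd j • radial (radD w) z := by
    intro w hw z hz j
    rw [fderiv_radial_apply hD hDr hw (hmem hz)]
    simp [b, EuclideanSpace.inner_single_right]
  have hX2 : ∀ i, fderiv ℝ (fun z => fderiv ℝ (radial u) z (b (Sum.inl i))) x (b (Sum.inl i))
      = radial (dX i (dX i u)) x := by
    intro i
    have : (fun z => fderiv ℝ (radial u) z (b (Sum.inl i))) =ᶠ[𝓝 x] radial (dX i u) := by
      filter_upwards [hΩ.mem_nhds hx] with z hz
      exact hX hu hz i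
    rw [this.fderiv_eq, hX (hu.dX hD hDr i) hx]
  have hQ2 : ∀ j, fderiv ℝ (fun z => fderiv ℝ (radial u) z (b (Sum.inr j))) x (b (Sum.inr j))
      = radial (radD u) x + (x.snd j) ^ 2 • radial (radD (radD u)) x := by
    intro j
    have h1 : (fun z => fderiv ℝ (radial u) z (b (Sum.inr j)))
        =ᶠ[𝓝 x] fun z => z.snd j • radial (radD u) z := by
      filter_upwards [hΩ.mem_nhds hx] with z hz
      exact hQ hu hz j
    let c : RPQ p q →L[ℝ] ℝ := (EuclideanSpace.proj j).comp (WithLp.sndL 2 ℝ (RP p) (RQ q))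
    have h2 : HasFDerivAt (fun z : RPQ p q => z.snd j) c x := c.hasFDerivAt
    have h3 := hasFDerivAt_radial hD hDr (hu.radD hD hDr) (hmem hx)
    have h4 : c (b (Sum.inr j)) = 1 := by simp [c, b]
    rw [h1.fderiv_eq, fderiv_fun_smul h2.differentiableAt h3.differentiableAt, h2.fderiv]
    rw [add_apply, smul_apply, hQ (hu.radD hD hDr) hx,
      ContinuousLinearMap.smulRight_apply, h4]
    module
  simp only [hX2, hQ2, Finset.sum_add_distrib, ← Finset.sum_smul]
  rw [← EuclideanSpace.real_norm_sq_eq]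
  simp only [radial, axialLap, lapX, polar, Finset.sum_const, Finset.card_univ, Fintype.card_fin]
  rw [← Nat.cast_smul_eq_nsmul ℝ, add_assoc]

/-- The operators `L_q` and `L_{3+2j}` differ only by `(q - 3 - 2j) T`, and the second one
annihilates `T^j u`. -/
theorem laplacian_iterate_radial (hq : 0 < q) (hD : IsOpen D) (hDr : ReflInvariant D)
    (hu : EvenSmooth D u) (h3 : ∀ y ∈ D, axialLap 3 u y = 0) (j : ℕ) :
    ∀ x ∈ completion q D,
      ((Laplacian.laplacian : (RPQ p q → Cl n) → RPQ p q → Cl n)^[j] (radial u)) x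
        = (∏ i ∈ Finset.range j, ((q : ℝ) - (3 + 2 * i))) • radial (radD^[j] u) x := by
  induction j with
  | zero => intro x _; simp
  | succ j ih =>
    intro x hx
    have hT := hu.radD_iterate hD hDr j
    have hΩ := isOpen_completion (q := q) hq hD
    have hev : ((Laplacian.laplacian : (RPQ p q → Cl n) → RPQ p q → Cl n)^[j] (radial u)) =ᶠ[𝓝 x]
        (∏ i ∈ Finset.range j, ((q : ℝ) - (3 + 2 * i))) • radial (radD^[j] u) := by
      filter_upwards [hΩ.mem_nhds hx] with z hz
      exact ih z hz
    have hc2 : ContDiffAt ℝ 2 (radial (radD^[j] u) : RPQ p q → Cl n) x :=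
      ((contDiffOn_radial hq hD hDr hT).contDiffAt (hΩ.mem_nhds hx)).of_le
        (WithTop.coe_le_coe.2 le_top)
    have hax : radial (axialLap q (radD^[j] u)) x
        = ((q : ℝ) - (3 + 2 * j)) • radial (radD^[j + 1] u) x := by
      have := axialLap_radD_iterate hD hDr hu h3 j (polar x) ((mem_completion_iff hq).1 hx)
      rw [Function.iterate_succ_apply']
      simp only [radial]
      rw [← sub_zero (axialLap _ _ _), ← this]
      simp only [axialLap]
      module
    rw [Function.iterate_succ_apply', (InnerProductSpace.laplacian_congr_nhds hev).self_of_nhds,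
      InnerProductSpace.laplacian_smul _ hc2, laplacian_radial hq hD hDr hT hx, hax, smul_smul,
      Finset.prod_range_succ]

theorem isPolyharmonic_radial {m : ℕ} (hm : 1 ≤ m) (hq : q = 2 * m + 1) (hD : IsOpen D)
    (hDr : ReflInvariant D) {u : RP p × ℝ → Cl (p + q)} (hu : EvenSmooth D u)
    (h3 : ∀ y ∈ D, axialLap 3 u y = 0) :
    IsPolyharmonic m (completion q D) (radial u) := by
  have hq0 : 0 < q := by omega
  refine ⟨(contDiffOn_radial hq0 hD hDr hu).of_le (WithTop.coe_le_coe.2 le_top),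
    fun x hx => ?_⟩
  -- The factor of index `m - 1` is `q - (3 + 2 (m - 1)) = 0`; here the oddness of `q` and `m ≥ 1`
  -- enter.
  rw [laplacian_iterate_radial hq0 hD hDr hu h3 m x hx,
    Finset.prod_eq_zero (Finset.mem_range.2 (Nat.sub_one_lt_of_lt hm)), zero_smul]
  rw [hq]
  push_cast [Nat.cast_sub hm]
  ring

theorem isSymm_radial (u : RP p × ℝ → Cl (p + q)) (Ω : Set (RPQ p q)) : IsSymm Ω (radial u) := by
  intro x _ I hI J hJ
  simp [radial, polar, pt, norm_smul_of_mem_sph hI, norm_smul_of_mem_sph hJ]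

end Radial

/-! ### Decompositions into symmetric functions -/

section Decomposition

variable {p q : ℕ} {D : Set (RP p × ℝ)} {f A B : RPQ p q → Cl (p + q)}

theorem polar_refl (x : RPQ p q) : polar (refl x) = polar x := by
  simp [polar, refl, pt]

theorem IsSymm.apply_refl (hq : 0 < q) {Ω : Set (RPQ p q)} (hA : IsSymm Ω A) {x : RPQ p q}
    (hx : x ∈ Ω) : A (refl x) = A x := by
  obtain ⟨w, hw, he⟩ := exists_mem_sph hq x.snd
  have h := hA x hx (-w) (neg_mem_sph hw) w hw
  rwa [smul_neg, ← he] at h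

/-- The spherical value and the spherical derivative in terms of a decomposition into symmetric
functions. -/
theorem sphVal_and_sphDeriv_of_decomposition (hq : 0 < q)
    (hA : IsSymm (completion q D) A) (hB : IsSymm (completion q D) B)
    (hf : ∀ x ∈ completion q D, f x = A x - star (emb x) * B x) {x : RPQ p q}
    (hx : x ∈ completion q D) :
    sphVal f x = A x - star (embP q x.fst) * B x ∧ (x.snd ≠ 0 → sphDeriv f x = B x) := by
  have hx' : refl x ∈ completion q D := by
    rw [mem_completion_iff hq, polar_refl]
    exact (mem_completion_iff hq).1 hx
  have h1 : f x = A x - star (embP q x.fst) * B x + embQ p x.snd * B x := by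
    rw [hf x hx, star_emb, sub_mul]
    abel
  have h2 : f (refl x) = A x - star (embP q x.fst) * B x - embQ p x.snd * B x := by
    rw [hf _ hx', star_emb, hA.apply_refl hq hx, hB.apply_refl hq hx]
    change A x - (star (embP q x.fst) - embQ p (-x.snd)) * B x = _
    rw [embQ_neg, sub_neg_eq_add, add_mul]
    abel
  constructor
  · rw [sphVal, h1, h2]
    module
  · intro h0
    have hn : ‖x.snd‖ ^ 2 ≠ 0 := pow_ne_zero 2 (norm_ne_zero_iff.2 h0)
    have h3 : f x - f (refl x) = (2 : ℝ) • (embQ p x.snd * B x) := by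
      rw [h1, h2]
      module
    rw [sphDeriv, h3, ringInverse_embQ h0, mul_smul_comm, smul_mul_assoc, ← mul_assoc,
      embQ_mul_self, smul_mul_assoc, one_mul, smul_smul, smul_smul, smul_smul, mul_assoc,
      neg_mul_neg, inv_mul_cancel₀ hn]
    norm_num

/-- A point of `ℝ^{p+1}` is a limit of points `x + t w` with `t ≠ 0` and `w` a unit vector of `ℝ^q`,
which lie off `ℝ^{p+1}`. -/
theorem eqOn_completion_of_snd_ne_zero (hq : 0 < q) (hD : IsOpen D)
    (hA : ContinuousOn A (completion q D)) (hB : ContinuousOn B (completion q D))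
    (h : ∀ x ∈ completion q D, x.snd ≠ 0 → A x = B x) : Set.EqOn A B (completion q D) := by
  intro x hx
  by_cases h0 : x.snd = 0
  · obtain ⟨w, hw, -⟩ := exists_mem_sph hq (0 : RQ q)
    let c : ℝ → RPQ p q := fun t => x + t • pt 0 w
    have hc0 : c 0 = x := by simp [c]
    have hcont : ContinuousAt c 0 := by fun_prop
    have hlim : Tendsto c (𝓝[≠] 0) (𝓝 x) := by
      rw [ContinuousAt, hc0] at hcont
      exact hcont.mono_left nhdsWithin_le_nhds
    have hmem : ∀ᶠ t in 𝓝[≠] (0 : ℝ), c t ∈ completion q D :=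
      hlim.eventually_mem ((isOpen_completion hq hD).mem_nhds hx)
    have hlim' : Tendsto c (𝓝[≠] 0) (𝓝[completion q D] x) :=
      tendsto_nhdsWithin_iff.2 ⟨hlim, hmem⟩
    refine tendsto_nhds_unique_of_eventuallyEq ((hA x hx).tendsto.comp hlim')
      ((hB x hx).tendsto.comp hlim') ?_
    filter_upwards [hmem, self_mem_nhdsWithin] with t ht ht0
    refine h _ ht ?_
    have hw0 : w ≠ 0 := by
      rintro rfl
      simp [sph] at hw
    have : (c t).snd = t • w := by simp [c, pt, h0]
    rw [this]
    exact smul_ne_zero ht0 hw0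
  · exact h x hx h0

theorem decomposition_unique (hq : 0 < q) (hD : IsOpen D) {A' B' : RPQ p q → Cl (p + q)}
    (hA : IsSymm (completion q D) A) (hB : IsSymm (completion q D) B)
    (hBc : ContinuousOn B (completion q D))
    (hf : ∀ x ∈ completion q D, f x = A x - star (emb x) * B x)
    (hA' : IsSymm (completion q D) A') (hB' : IsSymm (completion q D) B')
    (hBc' : ContinuousOn B' (completion q D))
    (hf' : ∀ x ∈ completion q D, f x = A' x - star (emb x) * B' x) :
    Set.EqOn A' A (completion q D) ∧ Set.EqOn B' B (completion q D) := by
  have hBB : Set.EqOn B' B (completion q D) := by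
    refine eqOn_completion_of_snd_ne_zero hq hD hBc' hBc fun x hx h0 => ?_
    rw [← (sphVal_and_sphDeriv_of_decomposition hq hA hB hf hx).2 h0,
      ← (sphVal_and_sphDeriv_of_decomposition hq hA' hB' hf' hx).2 h0]
  refine ⟨fun x hx => ?_, hBB⟩
  have := (hf' x hx).symm.trans (hf x hx)
  rw [hBB hx] at this
  exact sub_left_injective this

/-- A generalized partial-slice regular function decomposes into symmetric polyharmonic
functions. -/
theorem exists_decomposition {m : ℕ} (hm : 1 ≤ m) (hq : q = 2 * m + 1) (hD : IsOpen D)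
    (hDr : ReflInvariant D) (hf : IsGSR D f) :
    ∃ A B : RPQ p q → Cl (p + q), IsPolyharmonic m (completion q D) A ∧
      IsPolyharmonic m (completion q D) B ∧ IsSymm (completion q D) A ∧
      IsSymm (completion q D) B ∧ ∀ x ∈ completion q D, f x = A x - star (emb x) * B x := by
  obtain ⟨F₁, F₂, hind, hc₁, hc₂, hCR⟩ := hf
  have hq0 : 0 < q := by omega
  obtain ⟨hs₁, hs₂⟩ := contDiffOn_of_cauchyRiemann hD hc₁ hc₂ hCR
  have hF : EvenSmooth D F₁ := ⟨hs₁, hind.even⟩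
  have hw : EvenSmooth D (divR F₂) := evenSmooth_divR hD hs₂ hind.odd
  have hF₂ : Set.EqOn (fun y => y.2 • divR F₂ y) F₂ D := fun y hy =>
    snd_smul_divR (eq_zero_of_odd hind.odd) hy
  obtain ⟨h3w, h3F⟩ := axialLap_of_cauchyRiemann hD hDr hF hw
    (fun y hy => by rw [dR_congr hD hF₂ hy]; exact sub_eq_zero.1 (hCR y hy).1)
    (fun y hy => by
      rw [diracBar_congr hD hF₂ hy]
      exact eq_neg_of_add_eq_zero_left (hCR y hy).2)
  -- From `x̄ = x̄_p - x_q` it follows that `A - x̄ B = F₁ + x_q w`, and with `x_q = r ω` this is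
  -- `F₁ + ω F₂`.
  refine ⟨radial fun z => F₁ z + star (embP q z.1) * divR F₂ z, radial (divR F₂),
    isPolyharmonic_radial hm hq hD hDr (hF.add hw.conjMul) h3F,
    isPolyharmonic_radial hm hq hD hDr hw h3w, isSymm_radial _ _, isSymm_radial _ _,
    fun x hx => ?_⟩
  have hx' : (x.fst, ‖x.snd‖) ∈ D := (mem_completion_iff hq0).1 hx
  obtain ⟨w, hwS, he⟩ := exists_mem_sph hq0 x.snd
  have h1 : f x = F₁ (x.fst, ‖x.snd‖) + embQ p w * F₂ (x.fst, ‖x.snd‖) := by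
    rw [← hind.eq _ _ hx' w hwS, ← he]
    rfl
  have h2 : embQ p x.snd * divR F₂ (x.fst, ‖x.snd‖) = embQ p w * F₂ (x.fst, ‖x.snd‖) := by
    have : ‖x.snd‖ • divR F₂ (x.fst, ‖x.snd‖) = F₂ (x.fst, ‖x.snd‖) := hF₂ hx'
    rw [← this, mul_smul_comm, ← smul_mul_assoc, ← embQ_smul, ← he]
  rw [h1, ← h2, star_emb]
  simp only [radial, polar, sub_mul]
  abel

end Decomposition

/-! ### The first order system -/

section Slice

variable {p q : ℕ} {D : Set (RP p × ℝ)} {A B : RPQ p q → Cl (p + q)}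

theorem pt_smul_mem_completion (hq : 0 < q) (hDr : ReflInvariant D) {w : RQ q} (hw : w ∈ sph q)
    {a : RP p} {r : ℝ} (h : (a, r) ∈ D) : pt a (r • w) ∈ completion q D := by
  rw [mem_completion_iff hq]
  have : polar (pt a (r • w)) = (a, |r|) := by simp [polar, pt, norm_smul_of_mem_sph hw]
  rw [this]
  rcases abs_choice r with h' | h' <;> rw [h']
  · exact h
  · exact hDr a r h

theorem slice_eq_slice (hq : 0 < q) (hDr : ReflInvariant D) (hA : IsSymm (completion q D) A)
    {v w : RQ q} (hv : v ∈ sph q) (hw : w ∈ sph q) {y : RP p × ℝ} (hy : y ∈ D) :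
    slice v A y = slice w A y := by
  have h := hA _ (pt_smul_mem_completion hq hDr hv (a := y.1) (r := y.2) hy)
  have hn : ‖(pt y.1 (y.2 • v)).snd‖ = |y.2| := by simp [pt, norm_smul_of_mem_sph hv]
  rw [hn] at h
  change ∀ I ∈ sph q, ∀ J ∈ sph q, A (pt y.1 (|y.2| • I)) = A (pt y.1 (|y.2| • J)) at h
  -- Symmetry is stated at radius `|x_q| ≥ 0` only; for negative `r` it is applied in the directions
  -- `-v` and `-w`.
  rcases abs_choice y.2 with h' | h' <;> rw [h'] at h
  · exact h v hv w hw
  · simpa [slice] using h (-v) (neg_mem_sph hv) (-w) (neg_mem_sph hw)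

theorem slice_neg (hq : 0 < q) (hDr : ReflInvariant D) (hA : IsSymm (completion q D) A)
    {w : RQ q} (hw : w ∈ sph q) {a : RP p} {r : ℝ} (h : (a, r) ∈ D) :
    slice w A (a, -r) = slice w A (a, r) := by
  rw [← slice_eq_slice hq hDr hA (neg_mem_sph hw) hw h]
  simp [slice]

theorem contDiffOn_slice (hq : 0 < q) (hDr : ReflInvariant D)
    (hA : ContDiffOn ℝ 1 A (completion q D)) {w : RQ q} (hw : w ∈ sph q) :
    ContDiffOn ℝ 1 (slice w A) D := by
  have hc : ContDiff ℝ 1 (fun y : RP p × ℝ => (pt y.1 (y.2 • w) : RPQ p q)) :=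
    (WithLp.prodContinuousLinearEquiv 2 ℝ (RP p) (RQ q)).symm.contDiff.comp
      (contDiff_fst.prodMk (contDiff_snd.smul contDiff_const))
  exact hA.comp hc.contDiffOn fun y hy => pt_smul_mem_completion hq hDr hw hy

/-- The even component of the function `A - x̄ B`. -/
def evenPart (w : RQ q) (A B : RPQ p q → Cl (p + q)) (y : RP p × ℝ) : Cl (p + q) :=
  slice w A y - star (embP q y.1) * slice w B y

/-- The odd component of the function `A - x̄ B`. -/
def oddPart (w : RQ q) (B : RPQ p q → Cl (p + q)) (y : RP p × ℝ) : Cl (p + q) :=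
  y.2 • slice w B y

theorem isInducedBy_decomposition (hq : 0 < q) (hDr : ReflInvariant D)
    (hA : IsSymm (completion q D) A) (hB : IsSymm (completion q D) B) {w : RQ q}
    (hw : w ∈ sph q) :
    IsInducedBy D (evenPart w A B) (oddPart w B) fun x => A x - star (emb x) * B x where
  even a r h := by simp only [evenPart, slice_neg hq hDr hA hw h, slice_neg hq hDr hB hw h]
  odd a r h := by simp only [oddPart, slice_neg hq hDr hB hw h, neg_smul]
  eq a r h v hv := by
    have hA' : A (pt a (r • v)) = slice w A (a, r) := slice_eq_slice hq hDr hA hv hw h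
    have hB' : B (pt a (r • v)) = slice w B (a, r) := slice_eq_slice hq hDr hB hv hw h
    have he : star (emb (pt a (r • v))) = star (embP q a) - r • embQ p v := by
      rw [star_emb, ← embQ_smul]
      rfl
    simp only [hA', hB', he, evenPart, oddPart, sub_mul, smul_mul_assoc, mul_smul_comm]
    abel

/-- The inducing pair of a generalized partial-slice function is unique. -/
theorem IsInducedBy.unique {f : RPQ p q → Cl (p + q)} {F₁ F₂ G₁ G₂ : RP p × ℝ → Cl (p + q)}
    (hq : 0 < q) (hF : IsInducedBy D F₁ F₂ f) (hG : IsInducedBy D G₁ G₂ f) :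
    Set.EqOn F₁ G₁ D ∧ Set.EqOn F₂ G₂ D := by
  obtain ⟨w, hw, -⟩ := exists_mem_sph hq (0 : RQ q)
  have key : ∀ y ∈ D, F₁ y = G₁ y ∧ embQ p w * F₂ y = embQ p w * G₂ y := by
    rintro ⟨a, r⟩ hy
    have h1 := (hF.eq a r hy w hw).symm.trans (hG.eq a r hy w hw)
    have h2 := (hF.eq a r hy _ (neg_mem_sph hw)).symm.trans (hG.eq a r hy _ (neg_mem_sph hw))
    rw [embQ_neg, neg_mul, neg_mul] at h2
    have h3 : (2 : ℝ) • F₁ (a, r) = (2 : ℝ) • G₁ (a, r) := by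
      have := congrArg₂ (· + ·) h1 h2
      rw [two_smul, two_smul]
      convert this using 1 <;> abel
    have h4 := smul_right_injective _ (two_ne_zero (α := ℝ)) h3
    refine ⟨h4, ?_⟩
    rw [h4] at h1
    exact add_left_cancel h1
  refine ⟨fun y hy => (key y hy).1, fun y hy => ?_⟩
  have := congrArg (embQ p w * ·) (key y hy).2
  simp only [embQ_mul_embQ_of_mem_sph hw] at this
  exact neg_injective this

/-- The constant `p + 2` is the sum of `∑ eᵢ ēᵢ = p + 1`, from differentiating `x̄_p`, and of `1`,
from `∂_r (r B) = B + r ∂_r B`. -/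
theorem firstOrderSystem_iff (hq : 0 < q) (hD : IsOpen D) (hDr : ReflInvariant D)
    (hA : ContDiffOn ℝ 1 A (completion q D)) (hB : ContDiffOn ℝ 1 B (completion q D)) {w : RQ q}
    (hw : w ∈ sph q) :
    (∀ y ∈ D, dirac (evenPart w A B) y - dR (oddPart w B) y = 0 ∧
      diracBar (oddPart w B) y + dR (evenPart w A B) y = 0) ↔
      FirstOrderSystem D (slice w A) (slice w B) := by
  refine forall₂_congr fun y hy => ?_
  have hdA : DifferentiableAt ℝ (slice w A) y :=
    ((contDiffOn_slice hq hDr hA hw).contDiffAt (hD.mem_nhds hy)).differentiableAt one_ne_zero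
  have hcB := contDiffOn_slice hq hDr hB hw
  have hdB : DifferentiableAt ℝ (slice w B) y :=
    (hcB.contDiffAt (hD.mem_nhds hy)).differentiableAt one_ne_zero
  have hdC : DifferentiableAt ℝ (fun z => star (embP q z.1) * slice w B z) y :=
    ((contDiffOn_conjMul hcB).contDiffAt (hD.mem_nhds hy)).differentiableAt one_ne_zero
  have hsub : ∀ e, fderiv ℝ (evenPart w A B) y e
      = fderiv ℝ (slice w A) y e - fderiv ℝ (fun z => star (embP q z.1) * slice w B z) y e := by
    intro e
    have : fderiv ℝ (evenPart w A B) y = _ := fderiv_fun_sub hdA hdC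
    rw [this]
    rfl
  have hX : ∀ i, unitP p q i * dX i (evenPart w A B) y = unitP p q i * dX i (slice w A) y
      - (slice w B y + unitP p q i * (star (embP q y.1) * dX i (slice w B) y)) := by
    intro i
    rw [dX_eq, hsub, ← dX_eq, ← dX_eq, dX_conjMul hdB, mul_sub, mul_add, ← mul_assoc,
      unitP_mul_star_self, one_mul]
  have h1 : dirac (evenPart w A B) y = dirac (slice w A) y - (((p : ℝ) + 1) • slice w B y
      + ∑ i, unitP p q i * (star (embP q y.1) * dX i (slice w B) y)) := by
    simp only [dirac, hX, Finset.sum_sub_distrib, Finset.sum_add_distrib, Finset.sum_const,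
      Finset.card_univ, Fintype.card_fin]
    rw [← Nat.cast_smul_eq_nsmul ℝ]
    push_cast
    rfl
  have h2 : dR (oddPart w B) y = slice w B y + y.2 • dR (slice w B) y := dR_snd_smul hdB
  have h3 : diracBar (oddPart w B) y = y.2 • diracBar (slice w B) y := diracBar_snd_smul hdB
  have h4 : dR (evenPart w A B) y
      = dR (slice w A) y - star (embP q y.1) * dR (slice w B) y := by
    rw [dR_eq, hsub, ← dR_eq, ← dR_eq, dR_conjMul hdB]
  rw [h1, h2, h3, h4]
  refine and_congr ?_ ?_
  · conv_rhs => rw [← sub_eq_zero]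
    refine Eq.congr ?_ rfl
    module
  · refine Eq.congr ?_ rfl
    abel

/-- A regular function comes with some inducing pair; uniqueness identifies it on the open set `D`
with the explicit pair of every slice, so the derivatives agree too. In the other direction a single
slice is enough. -/
theorem isGSR_decomposition_iff (hq : 0 < q) (hD : IsOpen D) (hDr : ReflInvariant D)
    (hA : ContDiffOn ℝ 1 A (completion q D)) (hB : ContDiffOn ℝ 1 B (completion q D))
    (hAs : IsSymm (completion q D) A) (hBs : IsSymm (completion q D) B) :
    IsGSR D (fun x => A x - star (emb x) * B x) ↔
      ∀ w ∈ sph q, FirstOrderSystem D (slice w A) (slice w B) := by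
  constructor
  · rintro ⟨F₁, F₂, hind, -, -, hCR⟩ w hw
    obtain ⟨e₁, e₂⟩ := hind.unique hq (isInducedBy_decomposition hq hDr hAs hBs hw)
    refine (firstOrderSystem_iff hq hD hDr hA hB hw).1 fun y hy => ?_
    rw [← dirac_congr hD e₁ hy, ← diracBar_congr hD e₂ hy, ← dR_congr hD e₁ hy,
      ← dR_congr hD e₂ hy]
    exact hCR y hy
  · intro h
    obtain ⟨w, hw, -⟩ := exists_mem_sph hq (0 : RQ q)
    have hcB := contDiffOn_slice hq hDr hB hw
    exact ⟨evenPart w A B, oddPart w B, isInducedBy_decomposition hq hDr hAs hBs hw,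
      (contDiffOn_slice hq hDr hA hw).sub (contDiffOn_conjMul hcB),
      contDiffOn_snd.smul hcB, (firstOrderSystem_iff hq hD hDr hA hB hw).2 (h w hw)⟩

end Slice

end PartialSlice

end

theorem theorem3p4 (p q m : ℕ) (hm : 1 ≤ m) (hq : q = 2 * m + 1)
    (D : Set (PartialSlice.RP p × ℝ)) (hD : IsOpen D) (hDr : PartialSlice.ReflInvariant D) :
    (∀ f : PartialSlice.RPQ p q → PartialSlice.Cl (p + q), PartialSlice.IsGSR D f →
      ∃ A B : PartialSlice.RPQ p q → PartialSlice.Cl (p + q),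
        (PartialSlice.IsPolyharmonic m (PartialSlice.completion q D) A ∧
          PartialSlice.IsPolyharmonic m (PartialSlice.completion q D) B ∧
          PartialSlice.IsSymm (PartialSlice.completion q D) A ∧
          PartialSlice.IsSymm (PartialSlice.completion q D) B ∧
          ∀ x ∈ PartialSlice.completion q D,
            f x = A x - star (PartialSlice.emb x) * B x) ∧
        (∀ A' B' : PartialSlice.RPQ p q → PartialSlice.Cl (p + q),
          PartialSlice.IsPolyharmonic m (PartialSlice.completion q D) A' →
          PartialSlice.IsPolyharmonic m (PartialSlice.completion q D) B' →
          PartialSlice.IsSymm (PartialSlice.completion q D) A' →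
          PartialSlice.IsSymm (PartialSlice.completion q D) B' →
          (∀ x ∈ PartialSlice.completion q D,
            f x = A' x - star (PartialSlice.emb x) * B' x) →
          Set.EqOn A' A (PartialSlice.completion q D) ∧
          Set.EqOn B' B (PartialSlice.completion q D)) ∧
        (∀ x ∈ PartialSlice.completion q D, x.snd ≠ 0 → B x = PartialSlice.sphDeriv f x) ∧
        (∀ x ∈ PartialSlice.completion q D,
          A x = PartialSlice.sphVal f x + star (PartialSlice.embP q x.fst) * B x)) ∧
    (∀ A B : PartialSlice.RPQ p q → PartialSlice.Cl (p + q),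
      ContDiffOn ℝ 1 A (PartialSlice.completion q D) →
      ContDiffOn ℝ 1 B (PartialSlice.completion q D) →
      PartialSlice.IsSymm (PartialSlice.completion q D) A →
      PartialSlice.IsSymm (PartialSlice.completion q D) B →
      PartialSlice.IsGS D (fun x => A x - star (PartialSlice.emb x) * B x) ∧
      (PartialSlice.IsGSR D (fun x => A x - star (PartialSlice.emb x) * B x) ↔
        ∀ ω ∈ PartialSlice.sph q,
          PartialSlice.FirstOrderSystem D (PartialSlice.slice ω A) (PartialSlice.slice ω B))) := by
  have hq0 : 0 < q := by omega
  refine ⟨fun f hf => ?_, fun A B hA hB hAs hBs => ⟨?_, ?_⟩⟩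
  · obtain ⟨A, B, hA, hB, hAs, hBs, hfAB⟩ :=
      PartialSlice.exists_decomposition hm hq hD hDr hf
    refine ⟨A, B, ⟨hA, hB, hAs, hBs, hfAB⟩, fun A' B' _ hB' hAs' hBs' hf' => ?_,
      fun x hx h0 => ?_, fun x hx => ?_⟩
    · exact PartialSlice.decomposition_unique hq0 hD hAs hBs hB.1.continuousOn hfAB hAs' hBs'
        hB'.1.continuousOn hf'
    · exact ((PartialSlice.sphVal_and_sphDeriv_of_decomposition hq0 hAs hBs hfAB hx).2 h0).symm
    · rw [(PartialSlice.sphVal_and_sphDeriv_of_decomposition hq0 hAs hBs hfAB hx).1,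
        sub_add_cancel]
  · obtain ⟨w, hw, -⟩ := PartialSlice.exists_mem_sph hq0 (0 : PartialSlice.RQ q)
    exact ⟨_, _, PartialSlice.isInducedBy_decomposition hq0 hDr hAs hBs hw⟩
  · exact PartialSlice.isGSR_decomposition_iff hq0 hD hDr hA hB hAs hBs
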